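/- Let $\mathbb H$ be the algebra of real quaternions, $\mathbb S=\{q\in\mathbb H:\ q^2=-1\}$, and for $I\in\mathbb S$ let $\mathbb C_I=\mathbb R+\mathbb R I$ with $d\lambda_I(q)=dx\,dy$ for $q=x+yI$. A function $f:\mathbb H\to\mathbb H$ is slice regular if it is real differentiable and, for every $J\in\mathbb S$, its restriction $(x,y)\mapsto f(x+yJ)$ is $C^1$ and satisfies $\frac12\left(\frac{\partial}{\partial x}+J\frac{\partial}{\partial y}\right)f(x+yJ)=0$. Let $\nu>0$ and $I\in\mathbb S$. Let $\mathcal F^{2,\nu}_{slice}(\mathbb H)$ be the right $\mathbb H$-vector space of slice regular $f:\mathbb H\to\mathbb H$ with $\int_{\mathbb C_I}|f(q)|^2e^{-\nu|q|^2}d\lambda_I(q)<\infty$, with inner product $\langle f,g\rangle=\int_{\mathbb C_I}\overline{g(q)}f(q)e^{-\nu|q|^2}d\lambda_I(q)$. Let $L^2(\mathbb R)=L^2(\mathbb R;\mathbb H)$ be the right $\mathbb H$-vector space with inner product $\langle\varphi,\psi\rangle=\int_{\mathbb R}\overline{\psi(x)}\varphi(x)\,dx$, and for $\psi\in L^2(\mathbb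 R)$ and $q\in\mathbb H$ put $$\mathcal B_\nu(\psi)(q)=\left(\frac{\nu}{\pi}\right)^{3/4}\int_{\mathbb R}e^{-\frac{\nu}{2}(q^2+x^2)+\nu\sqrt2\,qx}\,\psi(x)\,dx .$$ Theorem. The integral defining $\mathcal B_\nu(\psi)(q)$ converges absolutely for all $\psi\in L^2(\mathbb R)$ and $q\in\mathbb H$, and $\mathcal B_\nu$ is a bijection from $L^2(\mathbb R)$ onto $\mathcal F^{2,\nu}_{slice}(\mathbb H)$. Its inverse $[\mathcal B_\nu]^{-1}$ is right $\mathbb H$-linear and unitary (it preserves the inner products, hence the norms) from $\mathcal F^{2,\nu}_{slice}(\mathbb H)$ onto $L^2(\mathbb R)$, and it is given by the integral representation $$[\mathcal B_\nu]^{-1}(f)(x)=\left(\frac{\nu}{\pi}\right)^{3/4}\int_{\mathbb C_I}e^{-\frac{\nu}{2}(\overline q^2+x^2)+\nu\sqrt2\,\overline q x}f(q)\,e^{-\nu|q|^2}\,d\lambda_I(q),$$ where for general $f\in\mathcal F^{2,\nu}_{slice}(\mathbb H)$ the integral is taken in the mean: for every $R$ the same integral over $\{q\in\mathbb C_I:\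 |q|<R\}$ converges absolutely for all $x\in\mathbb R$ and defines a function of $x$ in $L^2(\mathbb R)$, and as $R\to\infty$ these functions converge to $[\mathcal B_\nu]^{-1}(f)$ in the norm of $L^2(\mathbb R)$. For every $f$, the formula also holds literally at almost every $x$ at which the integral over $\mathbb C_I$ converges absolutely; and it converges absolutely at every $x\in\mathbb R$ if $|f(q)|\le Ce^{a|q|^2}$ on $\mathbb C_I$ for some real $C$ and some $a<\nu/2$ (in particular if $f$ is a polynomial $\sum_{n\le N}q^na_n$). -/

import Mathlib

open MeasureTheory Filter Topology
open scoped Quaternion MulOpposite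

noncomputable section

namespace SegalBargmann

/-- The parametrization `x + iy ↦ x + yI` of the slice `ℂ_I = ℝ + ℝI`; it carries Lebesgue measure
`dx dy` on `ℂ` to `dλ_I`. -/
def sliceMap (I : ℍ) (z : ℂ) : ℍ := (z.re : ℍ) + (z.im : ℍ) * I

/-- Slice (left) regular functions on the whole of `ℍ`: real differentiable, and for every imaginary
unit `I` the restriction to `ℂ_I` is `C¹` and satisfies `(1/2) (∂/∂x + I ∂/∂y) f(x + yI) = 0`. -/
structure SliceRegular (f : ℍ → ℍ) : Prop where
  differentiable : Differentiable ℝ f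
  contDiff_slice : ∀ I : ℍ, I ^ 2 = -1 → ContDiff ℝ 1 (fun z : ℂ => f (sliceMap I z))
  dbar_eq_zero : ∀ I : ℍ, I ^ 2 = -1 → ∀ x y : ℝ,
    (1 / 2 : ℝ) • (deriv (fun s : ℝ => f (sliceMap I ⟨s, y⟩)) x
      + I * deriv (fun t : ℝ => f (sliceMap I ⟨x, t⟩)) y) = 0

/-- The squared modulus on `ℂ_I` against the Gaussian weight `e^{-ν|q|²}`. -/
def fockDensity (ν : ℝ) (I : ℍ) (f : ℍ → ℍ) (z : ℂ) : ℝ :=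
  ‖f (sliceMap I z)‖ ^ 2 * Real.exp (-ν * ‖sliceMap I z‖ ^ 2)

lemma continuous_sliceMap (I : ℍ) : Continuous (sliceMap I) := by
  unfold sliceMap
  exact (Quaternion.continuous_coe.comp Complex.continuous_re).add
    ((Quaternion.continuous_coe.comp Complex.continuous_im).mul continuous_const)

lemma SliceRegular.diff_x {f : ℍ → ℍ} (hf : SliceRegular f) {I : ℍ} (x y : ℝ) :
    DifferentiableAt ℝ (fun s : ℝ => f (sliceMap I ⟨s, y⟩)) x := by
  have h : DifferentiableAt ℝ (fun s : ℝ => sliceMap I ⟨s, y⟩) x := by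
    have : (fun s : ℝ => sliceMap I ⟨s, y⟩) = fun s : ℝ => s • (1 : ℍ) + (y : ℍ) * I := by
      funext s; simp [sliceMap, Algebra.smul_def]
    rw [this]; fun_prop
  exact (hf.differentiable _).comp x h

lemma SliceRegular.diff_y {f : ℍ → ℍ} (hf : SliceRegular f) {I : ℍ} (x y : ℝ) :
    DifferentiableAt ℝ (fun t : ℝ => f (sliceMap I ⟨x, t⟩)) y := by
  have h : DifferentiableAt ℝ (fun t : ℝ => sliceMap I ⟨x, t⟩) y := by
    have : (fun t : ℝ => sliceMap I ⟨x, t⟩) = fun t : ℝ => (x : ℍ) + t • I := by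
      funext s; simp [sliceMap, Quaternion.coe_mul_eq_smul]
    rw [this]; fun_prop
  exact (hf.differentiable _).comp y h

lemma SliceRegular.zero : SliceRegular (0 : ℍ → ℍ) where
  differentiable := differentiable_const 0
  contDiff_slice _ _ := contDiff_const
  dbar_eq_zero I _ x y := by simp

lemma SliceRegular.add {f g : ℍ → ℍ} (hf : SliceRegular f) (hg : SliceRegular g) :
    SliceRegular (f + g) where
  differentiable := hf.differentiable.add hg.differentiable
  contDiff_slice I hI := (hf.contDiff_slice I hI).add (hg.contDiff_slice I hI)
  dbar_eq_zero I hI x y := by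
    have h1 := hf.dbar_eq_zero I hI x y
    have h2 := hg.dbar_eq_zero I hI x y
    simp only [Pi.add_apply]
    rw [deriv_fun_add (hf.diff_x x y) (hg.diff_x x y),
      deriv_fun_add (hf.diff_y x y) (hg.diff_y x y), mul_add, add_add_add_comm, smul_add, h1, h2,
      add_zero]

lemma SliceRegular.smul {f : ℍ → ℍ} (c : ℍᵐᵒᵖ) (hf : SliceRegular f) :
    SliceRegular (c • f) where
  differentiable := by
    have : c • f = fun q => f q * c.unop := by funext q; simp
    rw [this]; exact hf.differentiable.mul_const _
  contDiff_slice I hI := by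
    have : (fun z : ℂ => (c • f) (sliceMap I z)) = fun z => f (sliceMap I z) * c.unop := by
      funext q; simp
    rw [this]; exact (hf.contDiff_slice I hI).mul contDiff_const
  dbar_eq_zero I hI x y := by
    have h1 := hf.dbar_eq_zero I hI x y
    simp only [Pi.smul_apply, MulOpposite.smul_eq_mul_unop]
    rw [deriv_mul_const (hf.diff_x x y), deriv_mul_const (hf.diff_y x y), ← mul_assoc, ← add_mul,
      ← smul_mul_assoc, h1, zero_mul]

lemma SliceRegular.continuous_density {f : ℍ → ℍ} (hf : SliceRegular f) (ν : ℝ) (I : ℍ) :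
    Continuous (fockDensity ν I f) := by
  have h1 : Continuous fun z => f (sliceMap I z) :=
    hf.differentiable.continuous.comp (continuous_sliceMap I)
  have h2 := continuous_sliceMap I
  exact (h1.norm.pow 2).mul (Real.continuous_exp.comp (continuous_const.mul (h2.norm.pow 2)))

/-- The slice hyperholomorphic Bargmann-Fock space `F^{2,ν}_I(ℍ)`, a right `ℍ`-vector space. -/
def fock (ν : ℝ) (I : ℍ) : Submodule ℍᵐᵒᵖ (ℍ → ℍ) where
  carrier := {f | SliceRegular f ∧ Integrable (fockDensity ν I f)}
  zero_mem' := ⟨SliceRegular.zero, by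
    have : fockDensity ν I 0 = 0 := by funext z; simp [fockDensity]
    rw [this]; exact integrable_zero _ _ _⟩
  add_mem' := by
    rintro f g ⟨hf, hf'⟩ ⟨hg, hg'⟩
    refine ⟨hf.add hg, ((hf'.add hg').const_mul 2).mono'
      ((hf.add hg).continuous_density ν I).aestronglyMeasurable (ae_of_all _ fun z => ?_)⟩
    have hE := Real.exp_pos (-ν * ‖sliceMap I z‖ ^ 2)
    have h1 := norm_add_le (f (sliceMap I z)) (g (sliceMap I z))
    have h2 := norm_nonneg (f (sliceMap I z) + g (sliceMap I z))
    have h3 : ‖f (sliceMap I z) + g (sliceMap I z)‖ ^ 2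
        ≤ 2 * (‖f (sliceMap I z)‖ ^ 2 + ‖g (sliceMap I z)‖ ^ 2) := by
      nlinarith [sq_nonneg (‖f (sliceMap I z)‖ - ‖g (sliceMap I z)‖)]
    simp only [fockDensity, Pi.add_apply]
    rw [Real.norm_of_nonneg (by positivity), ← add_mul, ← mul_assoc]
    exact mul_le_mul_of_nonneg_right h3 hE.le
  smul_mem' := by
    rintro c f ⟨hf, hf'⟩
    refine ⟨hf.smul c, ?_⟩
    have : fockDensity ν I (c • f) = fun z => ‖c.unop‖ ^ 2 * fockDensity ν I f z := by
      funext z; simp [fockDensity]; ring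
    rw [this]; exact hf'.const_mul _

/-- `⟨f, g⟩ = ∫_{ℂ_I} conj(g(q)) f(q) e^{-ν|q|²} dλ_I(q)`. -/
def fockInner (ν : ℝ) (I : ℍ) (f g : ℍ → ℍ) : ℍ :=
  ∫ z : ℂ, Real.exp (-ν * ‖sliceMap I z‖ ^ 2) • (star (g (sliceMap I z)) * f (sliceMap I z))

/-- `L²(ℝ; ℍ)`; a right `ℍ`-vector space through Mathlib's `ℍᵐᵒᵖ`-module structure. -/
abbrev L2 : Type := Lp ℍ 2 (volume : Measure ℝ)

/-- `⟨φ, ψ⟩ = ∫_ℝ conj(ψ(x)) φ(x) dx`. -/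
def l2Inner (φ ψ : L2) : ℍ := ∫ x : ℝ, star (ψ x) * φ x

/-- `A(q; x) = (ν/π)^{3/4} exp(-(ν/2)(q² + x²) + ν √2 q x)`. -/
def kernel (ν : ℝ) (q : ℍ) (x : ℝ) : ℍ :=
  (ν / Real.pi) ^ (3 / 4 : ℝ) •
    NormedSpace.exp (-(ν / 2) • (q ^ 2 + (x : ℍ) ^ 2) + (ν * √2) • (q * (x : ℍ)))

/-- The quaternionic Segal-Bargmann transform. -/
def transform (ν : ℝ) (ψ : ℝ → ℍ) (q : ℍ) : ℍ := ∫ x : ℝ, kernel ν q x * ψ x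

/-- The integrand, at the point `q = sliceMap I z` of `ℂ_I`, of the inversion integral without its
constant: `exp(-(ν/2)(q̄² + x²) + ν √2 q̄ x) f(q) e^{-ν|q|²}`. -/
def inverseIntegrand (ν : ℝ) (I : ℍ) (f : ℍ → ℍ) (x : ℝ) (z : ℂ) : ℍ :=
  Real.exp (-ν * ‖sliceMap I z‖ ^ 2) •
    (NormedSpace.exp (-(ν / 2) • (star (sliceMap I z) ^ 2 + (x : ℍ) ^ 2)
        + (ν * √2) • (star (sliceMap I z) * (x : ℍ)))
      * f (sliceMap I z))

/-- The inversion integral over a part `s` of the slice. -/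
def inverseIntegral (ν : ℝ) (I : ℍ) (s : Set ℂ) (f : ℍ → ℍ) (x : ℝ) : ℍ :=
  (ν / Real.pi) ^ (3 / 4 : ℝ) • ∫ z in s, inverseIntegrand ν I f x z

end SegalBargmann

end

/-!
Left multiplication by `x + yI` makes `ℍ` a complex Hilbert space, a different one for each slice
`ℂ_I`, and slice regularity means holomorphy of all restrictions to slices with values in these
spaces. Restricted to one slice, the quaternionic transform becomes the classical Segal-Bargmann
transform of Hilbert-space-valued functions.

The classical transform is isometric: on the vertical line `Re z = u` its weighted modulus is that
of a Fourier transform of `ψ` times a real Gaussian centred at `√2 u`, so Plancherel's theorem on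
each line and a Gaussian integration in `u` give the `L²` norm of `ψ`. It is onto: it maps
`A(w̄; ·) e` to a multiple of the reproducing kernel at `w`, so a Fock space function orthogonal to
the range vanishes at every `w`. A slice regular function is determined by its values on one slice,
since these include the real axis, which meets every other slice; hence bijectivity passes from the
slice to `ℍ`. Finally the inverse of a unitary operator is its adjoint, and the adjoint of the
transform is the inversion integral, first on functions supported in a disc and then in the limit.
-/

noncomputable section

namespace SegalBargmann

section Plancherel

open FourierTransform SchwartzMap

variable {V F : Type*} [NormedAddCommGroup V] [InnerProductSpace ℝ V] [FiniteDimensional ℝ V]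
  [MeasurableSpace V] [BorelSpace V] [NormedAddCommGroup F] [InnerProductSpace ℂ F]

lemma continuous_fourier {g : V → F} (hg : Integrable g) : Continuous (𝓕 g) :=
  VectorFourier.fourierIntegral_continuous Real.continuous_fourierChar (L := innerₗ V)
    continuous_inner hg

lemma lintegral_enorm_sq_eq_eLpNorm_sq {α E : Type*} {m : MeasurableSpace α} {μ : Measure α}
    [NormedAddCommGroup E] (g : α → E) : ∫⁻ x, ‖g x‖ₑ ^ 2 ∂μ = eLpNorm g 2 μ ^ 2 := by
  have h := eLpNorm_nnreal_pow_eq_lintegral (f := g) (μ := μ) (p := 2) (by norm_num)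
  simpa using h.symm

variable [CompleteSpace F]

open scoped ContDiff in
theorem fourier_toLp_ae_eq {g : V → F} (h₁ : Integrable g) (h₂ : MemLp g 2) :
    (𝓕 (h₂.toLp g) : Lp F 2 (volume : Measure V)) =ᵐ[volume] 𝓕 g := by
  refine ae_eq_of_integral_contDiff_smul_eq ((Lp.memLp _).locallyIntegrable (by norm_num))
    (continuous_fourier h₁).locallyIntegrable fun φ hφ hc => ?_
  have hΦc : HasCompactSupport (Complex.ofRealCLM ∘ φ) := hc.comp_left rfl
  have hΦs : ContDiff ℝ ∞ (Complex.ofRealCLM ∘ φ) := by fun_prop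
  set Φ : 𝓢(V, ℂ) := hΦc.toSchwartzMap hΦs with hΦ
  have hΦφ (x : V) : Φ x = (φ x : ℂ) := by simp [hΦ]
  have distributional : ∫ ξ, 𝓕 Φ ξ • (h₂.toLp g) ξ = ∫ x, Φ x • (𝓕 (h₂.toLp g)) x := by
    have h := congrArg (fun T => T Φ) (Lp.fourier_toTemperedDistribution_eq (h₂.toLp g))
    simpa only [TemperedDistribution.fourier_apply, Lp.toTemperedDistribution_apply] using h
  have selfAdjoint : ∫ ξ, 𝓕 (Φ : V → ℂ) ξ • g ξ = ∫ x, Φ x • 𝓕 g x := by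
    simpa using! VectorFourier.integral_fourierIntegral_smul_eq_flip (L := innerₗ V)
      Real.continuous_fourierChar continuous_inner Φ.integrable h₁
  have representative : ∫ ξ, 𝓕 Φ ξ • (h₂.toLp g) ξ = ∫ ξ, 𝓕 (Φ : V → ℂ) ξ • g ξ := by
    refine integral_congr_ae ?_
    filter_upwards [h₂.coeFn_toLp] with ξ hξ
    rw [hξ, fourier_coe]
  rw [representative, selfAdjoint] at distributional
  simpa [hΦφ] using distributional.symm

theorem eLpNorm_fourier_two {g : V → F} (h₁ : Integrable g) (h₂ : MemLp g 2) :
    eLpNorm (𝓕 g) 2 volume = eLpNorm g 2 volume := by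
  rw [← eLpNorm_congr_ae (fourier_toLp_ae_eq h₁ h₂), ← eLpNorm_congr_ae h₂.coeFn_toLp,
    ← Lp.enorm_def, ← Lp.enorm_def, ← ofReal_norm, ← ofReal_norm, Lp.norm_fourier_eq]

theorem lintegral_enorm_integral_cexp_smul_sq {g : ℝ → F} (h₁ : Integrable g) (h₂ : MemLp g 2)
    {k : ℝ} (hk : 0 < k) :
    ∫⁻ v : ℝ, ‖∫ x : ℝ, Complex.exp (k * v * x * Complex.I) • g x‖ₑ ^ 2
      = ENNReal.ofReal (2 * Real.pi / k) * ∫⁻ x, ‖g x‖ₑ ^ 2 := by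
  have hscale : -(k / (2 * Real.pi)) ≠ 0 := neg_ne_zero.2 (by positivity)
  have fourier_eq (v : ℝ) : ∫ x : ℝ, Complex.exp (k * v * x * Complex.I) • g x
      = 𝓕 g (-(k / (2 * Real.pi)) * v) := by
    rw [Real.fourier_real_eq_integral_exp_smul]
    congr with x
    push_cast
    field_simp
  have hmeas : Measurable fun w => ‖𝓕 g w‖ₑ ^ 2 :=
    (continuous_fourier h₁).enorm.measurable.pow_const 2
  simp_rw [fourier_eq]
  rw [← lintegral_map hmeas (measurable_const_mul _), Real.map_volume_mul_left hscale,
    lintegral_smul_measure, lintegral_enorm_sq_eq_eLpNorm_sq, lintegral_enorm_sq_eq_eLpNorm_sq,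
    eLpNorm_fourier_two h₁ h₂, smul_eq_mul, inv_neg, abs_neg, inv_div, abs_of_pos (by positivity)]

end Plancherel

section Exponential

lemma norm_pow_sub_pow_le {𝔸 : Type*} [NormedRing 𝔸] [NormOneClass 𝔸] {a b : 𝔸} {M : ℝ}
    (ha : ‖a‖ ≤ M) (hb : ‖b‖ ≤ M) (n : ℕ) : ‖a ^ n - b ^ n‖ ≤ n * M ^ (n - 1) * ‖a - b‖ := by
  have hM : 0 ≤ M := (norm_nonneg a).trans ha
  induction n with
  | zero => simp
  | succ n ih =>
    have first : ‖a * (a ^ n - b ^ n)‖ ≤ M * (n * M ^ (n - 1) * ‖a - b‖) :=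
      (norm_mul_le _ _).trans (mul_le_mul ha ih (norm_nonneg _) hM)
    have second : ‖(a - b) * b ^ n‖ ≤ ‖a - b‖ * M ^ n :=
      (norm_mul_le _ _).trans (mul_le_mul_of_nonneg_left
        ((norm_pow_le _ _).trans (pow_le_pow_left₀ (norm_nonneg _) hb n)) (norm_nonneg _))
    calc ‖a ^ (n + 1) - b ^ (n + 1)‖
        = ‖a * (a ^ n - b ^ n) + (a - b) * b ^ n‖ := by
          rw [pow_succ', pow_succ']; congr 1; noncomm_ring
      _ ≤ M * (n * M ^ (n - 1) * ‖a - b‖) + ‖a - b‖ * M ^ n :=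
          (norm_add_le _ _).trans (add_le_add first second)
      _ = (n + 1 : ℕ) * M ^ (n + 1 - 1) * ‖a - b‖ := by
          cases n with
          | zero => simp
          | succ n => simp [pow_succ]; ring

lemma contDiff_exp (𝕜 : Type*) {𝔸 : Type*} [RCLike 𝕜] [NormedRing 𝔸] [NormedAlgebra 𝕜 𝔸]
    [CompleteSpace 𝔸] {n : WithTop ℕ∞} : ContDiff 𝕜 n (NormedSpace.exp : 𝔸 → 𝔸) :=
  contDiff_iff_contDiffAt.2 fun a => (NormedSpace.exp_analytic (𝕂 := 𝕜) a).contDiffAt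

lemma norm_exp_le (𝕜 : Type*) {𝔸 : Type*} [RCLike 𝕜] [NormedRing 𝔸] [NormOneClass 𝔸]
    [NormedAlgebra 𝕜 𝔸] [CompleteSpace 𝔸] (a : 𝔸) : ‖NormedSpace.exp a‖ ≤ Real.exp ‖a‖ := by
  have hs := NormedSpace.exp_series_hasSum_exp' (𝕂 := ℝ) ‖a‖
  rw [← Real.exp_eq_exp_ℝ] at hs
  rw [← (NormedSpace.exp_series_hasSum_exp' (𝕂 := 𝕜) a).tsum_eq]
  refine tsum_of_norm_bounded hs fun n => (norm_smul_le _ _).trans ?_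
  rw [norm_inv, RCLike.norm_natCast, smul_eq_mul]
  gcongr
  exact norm_pow_le _ _

lemma norm_exp_sub_exp_le (𝕜 : Type*) {𝔸 : Type*} [RCLike 𝕜] [NormedRing 𝔸] [NormOneClass 𝔸]
    [NormedAlgebra 𝕜 𝔸] [CompleteSpace 𝔸] {a b : 𝔸} {M : ℝ} (ha : ‖a‖ ≤ M) (hb : ‖b‖ ≤ M) :
    ‖NormedSpace.exp a - NormedSpace.exp b‖ ≤ Real.exp M * ‖a - b‖ := by
  have majorant : HasSum (fun n : ℕ => (n.factorial : ℝ)⁻¹ * (n * M ^ (n - 1) * ‖a - b‖))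
      (Real.exp M * ‖a - b‖) := by
    rw [← hasSum_nat_add_iff' 1]
    simp only [Finset.range_one, Finset.sum_singleton, Nat.cast_zero, zero_mul, mul_zero, sub_zero]
    rw [Real.exp_eq_exp_ℝ]
    refine ((NormedSpace.exp_series_hasSum_exp' (𝕂 := ℝ) M).mul_right ‖a - b‖).congr_fun
      fun n => ?_
    rw [Nat.factorial_succ, smul_eq_mul]
    have := Nat.factorial_ne_zero n
    push_cast
    field_simp
  rw [← ((NormedSpace.exp_series_hasSum_exp' (𝕂 := 𝕜) a).sub
    (NormedSpace.exp_series_hasSum_exp' (𝕂 := 𝕜) b)).tsum_eq]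
  refine tsum_of_norm_bounded majorant fun n => ?_
  rw [← smul_sub]
  refine (norm_smul_le _ _).trans ?_
  rw [norm_inv, RCLike.norm_natCast]
  gcongr
  exact norm_pow_sub_pow_le ha hb n

end Exponential

section Laplace

variable {𝕜 𝔸 E : Type*} [RCLike 𝕜] [NormedRing 𝔸] [NormOneClass 𝔸] [NormedAlgebra 𝕜 𝔸]
  [CompleteSpace 𝔸] [NormedAddCommGroup E] [Module 𝔸 E] [IsBoundedSMul 𝔸 E] {g : ℝ → E}

lemma norm_exp_ofReal_smul_le (x : ℝ) (q : 𝔸) :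
    ‖NormedSpace.exp ((x : 𝕜) • q)‖ ≤ Real.exp (‖q‖ * |x|) := by
  refine (norm_exp_le 𝕜 _).trans (Real.exp_le_exp.2 ((norm_smul_le _ _).trans_eq ?_))
  rw [RCLike.norm_ofReal, mul_comm]

lemma norm_exp_ofReal_smul_sub_le {q q' : 𝔸} {r : ℝ} (hq : ‖q‖ ≤ r) (hq' : ‖q'‖ ≤ r) (x : ℝ) :
    ‖NormedSpace.exp ((x : 𝕜) • q) - NormedSpace.exp ((x : 𝕜) • q')‖
      ≤ Real.exp ((r + 1) * |x|) * ‖q - q'‖ := by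
  have hle {p : 𝔸} (hp : ‖p‖ ≤ r) : ‖(x : 𝕜) • p‖ ≤ r * |x| := by
    refine (norm_smul_le _ _).trans ?_
    rw [RCLike.norm_ofReal, mul_comm]
    gcongr
  calc ‖NormedSpace.exp ((x : 𝕜) • q) - NormedSpace.exp ((x : 𝕜) • q')‖
      ≤ Real.exp (r * |x|) * ‖(x : 𝕜) • q - (x : 𝕜) • q'‖ :=
        norm_exp_sub_exp_le 𝕜 (hle hq) (hle hq')
    _ ≤ Real.exp (r * |x|) * (|x| * ‖q - q'‖) := by
        rw [← smul_sub]
        gcongr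
        exact (norm_smul_le _ _).trans_eq (by rw [RCLike.norm_ofReal])
    _ ≤ Real.exp (r * |x|) * (Real.exp |x| * ‖q - q'‖) := by
        gcongr
        linarith [Real.add_one_le_exp |x|]
    _ = Real.exp ((r + 1) * |x|) * ‖q - q'‖ := by rw [add_one_mul, Real.exp_add]; ring

variable (𝕜) in
theorem integrable_exp_ofReal_smul_smul (hgm : AEStronglyMeasurable g)
    (hg : ∀ K : ℝ, Integrable fun x => Real.exp (K * |x|) * ‖g x‖) (q : 𝔸) :
    Integrable fun x : ℝ => NormedSpace.exp ((x : 𝕜) • q) • g x := by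
  have hcont : Continuous fun x : ℝ => NormedSpace.exp ((x : 𝕜) • q) :=
    (contDiff_exp 𝕜 (n := 0)).continuous.comp (by fun_prop)
  refine (hg ‖q‖).mono' (hcont.aestronglyMeasurable.smul hgm) (ae_of_all _ fun x => ?_)
  exact (norm_smul_le _ _).trans
    (mul_le_mul_of_nonneg_right (norm_exp_ofReal_smul_le x q) (norm_nonneg _))

theorem differentiable_integral_exp_ofReal_smul_smul [NormedSpace 𝕜 E] [NormedSpace ℝ E]
    [IsScalarTower 𝕜 𝔸 E] (hgm : AEStronglyMeasurable g)
    (hg : ∀ K : ℝ, Integrable fun x => Real.exp (K * |x|) * ‖g x‖) :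
    Differentiable 𝕜 fun q : 𝔸 => ∫ x : ℝ, NormedSpace.exp ((x : 𝕜) • q) • g x := by
  intro q₀
  set exp' : 𝔸 → 𝔸 →L[𝕜] 𝔸 := fderiv 𝕜 NormedSpace.exp
  have hexp' : Continuous exp' := (contDiff_exp 𝕜 (n := 1)).continuous_fderiv one_ne_zero
  set lsmul : 𝔸 →L[𝕜] E →L[𝕜] E := ContinuousLinearMap.lsmul 𝕜 𝔸
  refine (hasFDerivAt_integral_of_dominated_loc_of_lip'
    (F' := fun x : ℝ => ContinuousLinearMap.compL 𝕜 𝔸 𝔸 E (lsmul.flip (g x))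
      ((x : 𝕜) • exp' ((x : 𝕜) • q₀)))
    (bound := fun x => Real.exp ((‖q₀‖ + 1 + 1) * |x|) * ‖g x‖) (Metric.ball_mem_nhds q₀ one_pos)
    (fun q _ => (integrable_exp_ofReal_smul_smul 𝕜 hgm hg q).aestronglyMeasurable)
    (integrable_exp_ofReal_smul_smul 𝕜 hgm hg q₀) ?meas (ae_of_all _ fun x q hq => ?lipschitz)
    (hg _) (ae_of_all _ fun x => ?deriv)).2.differentiableAt
  case meas =>
    refine ContinuousLinearMap.aestronglyMeasurable_comp₂ _ ?_ ?_
    · exact lsmul.flip.continuous.comp_aestronglyMeasurable hgm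
    · have hofReal : Continuous fun x : ℝ => (x : 𝕜) := RCLike.continuous_ofReal
      exact (hofReal.smul (hexp'.comp (hofReal.smul continuous_const))).aestronglyMeasurable
  case lipschitz =>
    have hq' : ‖q‖ ≤ ‖q₀‖ + 1 :=
      (norm_le_norm_add_norm_sub' q q₀).trans (by gcongr; exact (mem_ball_iff_norm.1 hq).le)
    calc ‖NormedSpace.exp ((x : 𝕜) • q) • g x - NormedSpace.exp ((x : 𝕜) • q₀) • g x‖
        ≤ ‖NormedSpace.exp ((x : 𝕜) • q) - NormedSpace.exp ((x : 𝕜) • q₀)‖ * ‖g x‖ := by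
          rw [← sub_smul]; exact norm_smul_le _ _
      _ ≤ Real.exp ((‖q₀‖ + 1 + 1) * |x|) * ‖q - q₀‖ * ‖g x‖ := by
          gcongr
          exact norm_exp_ofReal_smul_sub_le hq' (by simp) x
      _ = Real.exp ((‖q₀‖ + 1 + 1) * |x|) * ‖g x‖ * ‖q - q₀‖ := by ring
  case deriv =>
    have hexp : HasFDerivAt NormedSpace.exp (exp' ((x : 𝕜) • q₀)) ((x : 𝕜) • q₀) :=
      ((contDiff_exp 𝕜 (n := 1)).differentiable one_ne_zero _).hasFDerivAt
    have h := (lsmul.flip (g x)).hasFDerivAt.comp q₀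
      (hexp.comp q₀ ((hasFDerivAt_id (𝕜 := 𝕜) q₀).const_smul (x : 𝕜)))
    refine h.congr_fderiv ?_
    ext p
    simp

end Laplace

section Gaussian

variable {V : Type*} [NormedAddCommGroup V] [InnerProductSpace ℝ V] [FiniteDimensional ℝ V]
  [MeasurableSpace V] [BorelSpace V]

lemma integrable_exp_neg_mul_norm_sq {b : ℝ} (hb : 0 < b) :
    Integrable fun v : V => Real.exp (-b * ‖v‖ ^ 2) := by
  have h := (GaussianFourier.integrable_cexp_neg_mul_sq_norm_add (V := V) (b := (b : ℂ))
    (by simpa using hb) 0 0).norm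
  refine h.congr (ae_of_all _ fun v => ?_)
  simp only [Complex.norm_exp]
  norm_cast
  simp

lemma integrable_exp_mul_norm_sub_sq {b : ℝ} (hb : 0 < b) (K : ℝ) :
    Integrable fun v : V => Real.exp (K * ‖v‖ - b * ‖v‖ ^ 2) := by
  refine ((integrable_exp_neg_mul_norm_sq (V := V) (half_pos hb)).const_mul
    (Real.exp (K ^ 2 / (2 * b)))).mono' (by fun_prop) (ae_of_all _ fun v => ?_)
  rw [Real.norm_of_nonneg (Real.exp_pos _).le, ← Real.exp_add]
  have completedSquare : K ^ 2 / (2 * b) + -(b / 2) * ‖v‖ ^ 2 - (K * ‖v‖ - b * ‖v‖ ^ 2)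
      = (K - b * ‖v‖) ^ 2 / (2 * b) := by field_simp; ring
  have : 0 ≤ (K - b * ‖v‖) ^ 2 / (2 * b) := by positivity
  exact Real.exp_le_exp.2 (by linarith)

lemma memLp_two_exp_mul_norm_sub_sq {b : ℝ} (hb : 0 < b) (K : ℝ) :
    MemLp (fun v : V => Real.exp (K * ‖v‖ - b * ‖v‖ ^ 2)) 2 := by
  rw [memLp_two_iff_integrable_sq (by fun_prop)]
  refine (integrable_exp_mul_norm_sub_sq (V := V) (b := 2 * b) (by positivity) (2 * K)).congr
    (ae_of_all _ fun v => ?_)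
  simp only [← Real.exp_nat_mul]
  congr 1; push_cast; ring

lemma integrable_exp_mul_norm_gaussian_smul {F : Type*} [NormedAddCommGroup F] [NormedSpace ℝ F]
    {b : ℝ} (hb : 0 < b) {ψ : V → F} (hψ : MemLp ψ 2) (K : ℝ) :
    Integrable fun x : V => Real.exp (K * ‖x‖) * ‖Real.exp (-b * ‖x‖ ^ 2) • ψ x‖ := by
  refine ((memLp_two_exp_mul_norm_sub_sq (V := V) hb K).integrable_mul hψ.norm).congr
    (ae_of_all _ fun x => ?_)
  simp only [Pi.mul_apply, norm_smul, Real.norm_of_nonneg (Real.exp_pos _).le, ← mul_assoc,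
    ← Real.exp_add]
  congr 2; ring

end Gaussian

section Kernel

variable {𝔸 : Type*} [NormedRing 𝔸] [NormedAlgebra ℝ 𝔸]

/-- The Segal-Bargmann kernel at an element `q` of a real Banach algebra. At `𝔸 = ℍ` it is
`kernel`, at `𝔸 = ℂ` the kernel of the classical transform. -/
def bargmannKernel (ν : ℝ) (q : 𝔸) (x : ℝ) : 𝔸 :=
  (ν / Real.pi) ^ (3 / 4 : ℝ) • NormedSpace.exp
    (-(ν / 2) • (q ^ 2 + algebraMap ℝ 𝔸 x ^ 2) + (ν * √2) • (q * algebraMap ℝ 𝔸 x))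

lemma kernel_eq_bargmannKernel : kernel = bargmannKernel (𝔸 := ℍ) := rfl

lemma map_bargmannKernel {𝔹 : Type*} [NormedRing 𝔹] [NormedAlgebra ℝ 𝔹] [CompleteSpace 𝔸]
    (φ : 𝔸 →A[ℝ] 𝔹) (ν : ℝ) (q : 𝔸) (x : ℝ) :
    φ (bargmannKernel ν q x) = bargmannKernel ν (φ q) x := by
  let : NormedAlgebra ℚ 𝔸 := NormedAlgebra.restrictScalars ℚ ℝ 𝔸
  let : Algebra ℚ 𝔹 := (NormedAlgebra.restrictScalars ℚ ℝ 𝔹).toAlgebra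
  simp only [bargmannKernel, map_smul, NormedSpace.map_exp φ φ.continuous, map_add, map_mul,
    map_pow, AlgHomClass.commutes]

lemma bargmannKernel_eq_mul [CompleteSpace 𝔸] (ν : ℝ) (q : 𝔸) (x : ℝ) :
    bargmannKernel ν q x = ((ν / Real.pi) ^ (3 / 4 : ℝ) • NormedSpace.exp (-(ν / 2) • q ^ 2)) *
      (Real.exp (-(ν / 2) * ‖x‖ ^ 2) • NormedSpace.exp (x • (ν * √2) • q)) := by
  let : NormedAlgebra ℚ 𝔸 := NormedAlgebra.restrictScalars ℚ ℝ 𝔸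
  have hgauss : Real.exp (-(ν / 2) * ‖x‖ ^ 2) • (1 : 𝔸)
      = NormedSpace.exp (algebraMap ℝ 𝔸 (-(ν / 2) * ‖x‖ ^ 2)) := by
    rw [← NormedSpace.algebraMap_exp_comm, ← Real.exp_eq_exp_ℝ, Algebra.algebraMap_eq_smul_one]
  have hlinear : (ν * √2) • (q * algebraMap ℝ 𝔸 x) = x • (ν * √2) • q := by
    rw [← Algebra.commutes, ← Algebra.smul_def, smul_comm]
  have hquadratic : -(ν / 2) • algebraMap ℝ 𝔸 x ^ 2 = algebraMap ℝ 𝔸 (-(ν / 2) * ‖x‖ ^ 2) := by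
    rw [← map_pow, Algebra.smul_def, ← map_mul, Real.norm_eq_abs, sq_abs]
  have hcommute : Commute (-(ν / 2) • q ^ 2)
      (algebraMap ℝ 𝔸 (-(ν / 2) * ‖x‖ ^ 2) + x • (ν * √2) • q) :=
    (Algebra.commute_algebraMap_right _ _).add_right
      (((((Commute.refl q).pow_left 2).smul_right _).smul_right _).smul_left _)
  rw [bargmannKernel, hlinear, smul_add, hquadratic, add_assoc,
    NormedSpace.exp_add_of_commute hcommute,
    NormedSpace.exp_add_of_commute (Algebra.commute_algebraMap_left _ _), ← hgauss,
    smul_mul_assoc, smul_mul_assoc, one_mul]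

lemma continuous_bargmannKernel [CompleteSpace 𝔸] (ν : ℝ) :
    Continuous fun p : 𝔸 × ℝ => bargmannKernel ν p.1 p.2 := by
  let : NormedAlgebra ℚ 𝔸 := NormedAlgebra.restrictScalars ℚ ℝ 𝔸
  have := continuous_algebraMap ℝ 𝔸
  have : Continuous (NormedSpace.exp : 𝔸 → 𝔸) := NormedSpace.exp_continuous
  unfold bargmannKernel
  fun_prop

end Kernel

section Transform

variable {𝔸 E : Type*} [NormedRing 𝔸] [NormedAlgebra ℝ 𝔸] [NormedAddCommGroup E] [NormedSpace ℝ E]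
  [Module 𝔸 E]

/-- The Segal-Bargmann transform of a function with values in a module `E` over a real Banach
algebra `𝔸`. At `𝔸 = E = ℍ` it is `transform`. -/
def bargmannTransform (ν : ℝ) (ψ : ℝ → E) (q : 𝔸) : E := ∫ x : ℝ, bargmannKernel ν q x • ψ x

lemma transform_eq_bargmannTransform : transform = bargmannTransform (𝔸 := ℍ) (E := ℍ) := rfl

lemma bargmannTransform_congr_ae (ν : ℝ) {φ ψ : ℝ → E} (h : φ =ᵐ[volume] ψ) :
    (bargmannTransform ν φ : 𝔸 → E) = bargmannTransform ν ψ :=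
  funext fun _ => integral_congr_ae (h.mono fun _ hx => congrArg (_ • ·) hx)

variable [CompleteSpace 𝔸] {ν : ℝ} {φ ψ : ℝ → E}

lemma bargmannKernel_smul_eq [IsScalarTower ℝ 𝔸 E] (ν : ℝ) (ψ : ℝ → E) (q : 𝔸) (x : ℝ) :
    bargmannKernel ν q x • ψ x
      = ((ν / Real.pi) ^ (3 / 4 : ℝ) • NormedSpace.exp (-(ν / 2) • q ^ 2)) •
        NormedSpace.exp (x • (ν * √2) • q) • Real.exp (-(ν / 2) * ‖x‖ ^ 2) • ψ x := by
  rw [bargmannKernel_eq_mul, mul_smul, smul_assoc (Real.exp _), smul_comm (Real.exp _)]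

variable [NormOneClass 𝔸] [IsBoundedSMul 𝔸 E]

lemma integrable_exp_smul_gaussian_smul (hν : 0 < ν) (hψ : MemLp ψ 2) (q : 𝔸) :
    Integrable fun x : ℝ => NormedSpace.exp (x • q) • Real.exp (-(ν / 2) * ‖x‖ ^ 2) • ψ x :=
  integrable_exp_ofReal_smul_smul ℝ
    ((by fun_prop : Continuous fun x : ℝ => Real.exp (-(ν / 2) * ‖x‖ ^ 2)).aestronglyMeasurable.smul
      hψ.1) (integrable_exp_mul_norm_gaussian_smul (half_pos hν) hψ) q

variable [IsScalarTower ℝ 𝔸 E]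

theorem integrable_bargmannKernel_smul (hν : 0 < ν) (hψ : MemLp ψ 2) (q : 𝔸) :
    Integrable fun x : ℝ => bargmannKernel ν q x • ψ x := by
  simp_rw [bargmannKernel_smul_eq]
  exact (integrable_exp_smul_gaussian_smul hν hψ _).smul
    ((ν / Real.pi) ^ (3 / 4 : ℝ) • NormedSpace.exp (-(ν / 2) • q ^ 2))

lemma bargmannTransform_add (hν : 0 < ν) (hφ : MemLp φ 2) (hψ : MemLp ψ 2) :
    (bargmannTransform ν (φ + ψ) : 𝔸 → E)
      = bargmannTransform ν φ + bargmannTransform ν ψ := by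
  funext q
  simp only [bargmannTransform, Pi.add_apply, smul_add]
  exact integral_add (integrable_bargmannKernel_smul hν hφ q)
    (integrable_bargmannKernel_smul hν hψ q)

lemma bargmannTransform_smul {R : Type*} [NormedRing R] [Module R E] [IsBoundedSMul R E]
    [SMulCommClass ℝ R E] [SMulCommClass 𝔸 R E] (hν : 0 < ν) (c : R) (hψ : MemLp ψ 2) :
    (bargmannTransform ν (c • ψ) : 𝔸 → E) = c • bargmannTransform ν ψ := by
  funext q
  simp only [bargmannTransform, Pi.smul_apply, smul_comm (bargmannKernel ν q _) c]
  exact (integrable_bargmannKernel_smul hν hψ q).integral_smul c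

theorem differentiable_bargmannTransform (𝕜 : Type*) [RCLike 𝕜] [NormedAlgebra 𝕜 𝔸]
    [IsScalarTower ℝ 𝕜 𝔸] [NormedSpace 𝕜 E] [IsScalarTower 𝕜 𝔸 E] [CompleteSpace E] (hν : 0 < ν)
    (hψ : MemLp ψ 2) : Differentiable 𝕜 (bargmannTransform ν ψ : 𝔸 → E) := by
  set g : ℝ → E := fun x => Real.exp (-(ν / 2) * ‖x‖ ^ 2) • ψ x
  have hgm : AEStronglyMeasurable g :=
    (by fun_prop : Continuous fun x : ℝ => Real.exp (-(ν / 2) * ‖x‖ ^ 2)).aestronglyMeasurable.smul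
      hψ.1
  have laplace : Differentiable 𝕜 fun q : 𝔸 => ∫ x : ℝ, NormedSpace.exp (x • q) • g x := by
    simpa only [RCLike.real_smul_eq_coe_smul (K := 𝕜)] using
      differentiable_integral_exp_ofReal_smul_smul (𝕜 := 𝕜) (𝔸 := 𝔸) hgm
        (integrable_exp_mul_norm_gaussian_smul (half_pos hν) hψ)
  have gaussian : Differentiable 𝕜 fun q : 𝔸 =>
      (ν / Real.pi) ^ (3 / 4 : ℝ) • NormedSpace.exp (-(ν / 2) • q ^ 2) := by
    have hexp := (contDiff_exp (𝔸 := 𝔸) 𝕜 (n := 1)).differentiable one_ne_zero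
    have hsq : Differentiable 𝕜 fun q : 𝔸 => -(ν / 2) • q ^ 2 :=
      (differentiable_id.pow 2).const_smul (-(ν / 2))
    exact (hexp.comp hsq).const_smul ((ν / Real.pi) ^ (3 / 4 : ℝ))
  let act : 𝔸 →L[𝕜] E →L[𝕜] E := ContinuousLinearMap.lsmul 𝕜 𝔸
  have factorization : (bargmannTransform ν ψ : 𝔸 → E) = fun q =>
      act ((ν / Real.pi) ^ (3 / 4 : ℝ) • NormedSpace.exp (-(ν / 2) • q ^ 2))
        (∫ x : ℝ, NormedSpace.exp (x • (ν * √2) • q) • g x) := by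
    funext q
    rw [← ContinuousLinearMap.integral_comp_comm _ (integrable_exp_smul_gaussian_smul hν hψ _)]
    simp only [bargmannTransform, bargmannKernel_smul_eq, act, ContinuousLinearMap.lsmul_apply]
  rw [factorization]
  exact (act.differentiable.comp gaussian).clm_apply
    (laplace.comp (differentiable_id.const_smul (ν * √2)))

end Transform

section WeightedTransform

/-- `f` multiplied by the square root of the Gaussian weight `e^{-ν|z|²}`; the norm of `f` in the
Fock space is the `L²` norm of `weighted ν f` with respect to Lebesgue measure. -/
def weighted {F : Type*} [SMul ℝ F] (ν : ℝ) (f : ℂ → F) (z : ℂ) : F :=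
  Real.exp (-(ν / 2) * ‖z‖ ^ 2) • f z

lemma norm_weighted_sq {F : Type*} [NormedAddCommGroup F] [NormedSpace ℝ F] (ν : ℝ) (f : ℂ → F)
    (z : ℂ) : ‖weighted ν f z‖ ^ 2 = ‖f z‖ ^ 2 * Real.exp (-ν * ‖z‖ ^ 2) := by
  rw [weighted, norm_smul, Real.norm_of_nonneg (Real.exp_pos _).le, mul_pow, ← Real.exp_nat_mul,
    mul_comm]
  congr 2
  push_cast
  ring

lemma weighted_add {F : Type*} [AddZeroClass F] [DistribSMul ℝ F] (ν : ℝ) (f g : ℂ → F) :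
    weighted ν (f + g) = weighted ν f + weighted ν g :=
  funext fun _ => smul_add _ _ _

lemma weighted_sub {F : Type*} [AddGroup F] [DistribMulAction ℝ F] (ν : ℝ) (f g : ℂ → F) :
    weighted ν (f - g) = weighted ν f - weighted ν g :=
  funext fun _ => smul_sub _ _ _

/-- The modulus of the weighted kernel `e^{-ν|z|²/2} A(z; x)` at a complex number `z` with real
part `u`. -/
def kernelModulus (ν u x : ℝ) : ℝ :=
  (ν / Real.pi) ^ (3 / 4 : ℝ) * Real.exp (-(ν / 2) * (√2 * u - x) ^ 2)

lemma weighted_bargmannKernel (ν : ℝ) (z : ℂ) (x : ℝ) :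
    weighted ν (fun w => bargmannKernel ν w x) z
      = Complex.exp (-(ν * z.re * z.im) * Complex.I) *
        (Complex.exp ((ν * √2 : ℝ) * z.im * x * Complex.I) * kernelModulus ν z.re x) := by
  have hsqrt : ((√2 : ℝ) : ℂ) ^ 2 = 2 := by rw [← Complex.ofReal_pow]; simp
  have hnorm : ((‖z‖ : ℝ) : ℂ) ^ 2 = z.re ^ 2 + z.im ^ 2 := by
    rw [← Complex.ofReal_pow, ← Complex.normSq_eq_norm_sq, Complex.normSq_apply]
    push_cast
    ring
  have hexponent : -(ν / 2) * ((‖z‖ : ℝ) : ℂ) ^ 2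
        + (-(ν / 2) * (z ^ 2 + x ^ 2) + ν * √2 * (z * x))
      = -(ν * z.re * z.im) * Complex.I + ((ν * √2 : ℝ) * z.im * x * Complex.I
        + -(ν / 2) * (√2 * z.re - x) ^ 2) := by
    rw [hnorm]
    nth_rewrite 3 4 [← Complex.re_add_im z]
    push_cast
    linear_combination (ν * z.re ^ 2 / 2) * hsqrt - (ν * z.im ^ 2 / 2) * Complex.I_sq
  simp only [weighted, bargmannKernel, kernelModulus, ← Complex.exp_eq_exp_ℂ, Complex.real_smul,
    Complex.coe_algebraMap, Complex.ofReal_mul, Complex.ofReal_exp]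
  rw [mul_left_comm, ← Complex.exp_add, mul_left_comm (Complex.exp (_ * _ * Complex.I)),
    mul_left_comm (Complex.exp (_ * Complex.I)), ← Complex.exp_add, ← Complex.exp_add]
  congr 2
  push_cast at hexponent ⊢
  exact hexponent

lemma kernelModulus_nonneg {ν : ℝ} (hν : 0 < ν) (u x : ℝ) : 0 ≤ kernelModulus ν u x := by
  unfold kernelModulus
  positivity

lemma norm_weighted_bargmannKernel {ν : ℝ} (hν : 0 < ν) (z : ℂ) (x : ℝ) :
    ‖weighted ν (fun w => bargmannKernel ν w x) z‖ = kernelModulus ν z.re x := by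
  rw [weighted_bargmannKernel, norm_mul, norm_mul, Complex.norm_real,
    Real.norm_of_nonneg (kernelModulus_nonneg hν _ _), Complex.norm_exp, Complex.norm_exp]
  simp

lemma memLp_two_kernelModulus {ν : ℝ} (hν : 0 < ν) (u : ℝ) : MemLp (kernelModulus ν u) 2 := by
  have h := ((memLp_two_exp_mul_norm_sub_sq (V := ℝ) (half_pos hν) 0).comp_measurePreserving
    (volume.measurePreserving_sub_left (√2 * u))).const_mul ((ν / Real.pi) ^ (3 / 4 : ℝ))
  refine h.ae_eq (ae_of_all _ fun x => ?_)
  simp [kernelModulus]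

lemma norm_kernelModulus_le {ν : ℝ} (hν : 0 < ν) (u x : ℝ) :
    ‖kernelModulus ν u x‖ ≤ (ν / Real.pi) ^ (3 / 4 : ℝ) := by
  rw [kernelModulus, Real.norm_of_nonneg (by positivity)]
  refine mul_le_of_le_one_right (by positivity) (Real.exp_le_one_iff.2 ?_)
  nlinarith [sq_nonneg (√2 * u - x)]

lemma lintegral_enorm_kernelModulus_sq {ν : ℝ} (hν : 0 < ν) (x : ℝ) :
    ∫⁻ u : ℝ, ENNReal.ofReal (2 * Real.pi / (ν * √2)) * ‖kernelModulus ν u x‖ₑ ^ 2 = 1 := by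
  have hsqrt : √2 ^ 2 = 2 := by simp
  have hpow : ((ν / Real.pi) ^ (3 / 4 : ℝ)) ^ 2 = (ν / Real.pi) * √(ν / Real.pi) := by
    rw [← Real.rpow_mul_natCast (by positivity), Real.sqrt_eq_rpow,
      ← Real.rpow_one_add' (by positivity) (by norm_num)]
    norm_num
  have centred (u : ℝ) : ENNReal.ofReal (2 * Real.pi / (ν * √2)) * ‖kernelModulus ν u x‖ₑ ^ 2
      = ENNReal.ofReal (√2 * √(ν / Real.pi) * Real.exp (-(2 * ν) * (u - x / √2) ^ 2)) := by
    rw [Real.enorm_eq_ofReal_abs, ← ENNReal.ofReal_pow (abs_nonneg _), sq_abs,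
      ← ENNReal.ofReal_mul (by positivity), kernelModulus, mul_pow, hpow, ← Real.exp_nat_mul]
    have hexponent : ((2 : ℕ) : ℝ) * (-(ν / 2) * (√2 * u - x) ^ 2)
        = -(2 * ν) * (u - x / √2) ^ 2 := by
      have : √2 * u - x = √2 * (u - x / √2) := by field_simp
      rw [this, mul_pow, hsqrt]
      push_cast
      ring
    rw [hexponent]
    congr 1
    field_simp
    rw [hsqrt]
  have hint : Integrable fun u : ℝ => Real.exp (-(2 * ν) * (u - x / √2) ^ 2) :=
    (integrable_exp_neg_mul_sq (b := 2 * ν) (by positivity)).comp_sub_right (x / √2)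
  simp_rw [centred]
  rw [← ofReal_integral_eq_lintegral_ofReal (hint.const_mul _)
    (ae_of_all _ fun u => by positivity), integral_const_mul,
    integral_sub_right_eq_self (fun u : ℝ => Real.exp (-(2 * ν) * u ^ 2)) (x / √2),
    integral_gaussian, ENNReal.ofReal_eq_one, ← Real.sqrt_mul (by norm_num),
    ← Real.sqrt_mul (by positivity), Real.sqrt_eq_one]
  field_simp

variable {F : Type*} [NormedAddCommGroup F] [InnerProductSpace ℂ F] {ν : ℝ} {ψ : ℝ → F}

lemma weighted_bargmannTransform (ν : ℝ) (ψ : ℝ → F) (z : ℂ) :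
    weighted ν (bargmannTransform ν ψ) z
      = ∫ x : ℝ, weighted ν (fun w => bargmannKernel ν w x) z • ψ x := by
  simp only [weighted, bargmannTransform, smul_assoc, integral_smul]

lemma enorm_weighted_bargmannTransform (ν : ℝ) (ψ : ℝ → F) (z : ℂ) :
    ‖weighted ν (bargmannTransform ν ψ) z‖ₑ = ‖∫ x : ℝ,
      Complex.exp ((ν * √2 : ℝ) * z.im * x * Complex.I) • kernelModulus ν z.re x • ψ x‖ₑ := by
  have hphase : ‖Complex.exp (-(ν * z.re * z.im) * Complex.I)‖ₑ = 1 := by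
    rw [← ofReal_norm, Complex.norm_exp]
    simp
  simp only [weighted_bargmannTransform, weighted_bargmannKernel, mul_smul, integral_smul,
    enorm_smul, hphase, one_mul, Complex.coe_smul]

variable [CompleteSpace F]

lemma lintegral_enorm_weighted_bargmannTransform_vertical (hν : 0 < ν) (hψ : MemLp ψ 2) (u : ℝ) :
    ∫⁻ v : ℝ, ‖weighted ν (bargmannTransform ν ψ) ⟨u, v⟩‖ₑ ^ 2 = ∫⁻ x : ℝ,
      ENNReal.ofReal (2 * Real.pi / (ν * √2)) * ‖kernelModulus ν u x‖ₑ ^ 2 * ‖ψ x‖ₑ ^ 2 := by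
  have h₁ : Integrable fun x => kernelModulus ν u x • ψ x :=
    memLp_one_iff_integrable.1 (MemLp.smul (𝕜 := ℝ) hψ (memLp_two_kernelModulus hν u))
  have h₂ : MemLp (fun x => kernelModulus ν u x • ψ x) 2 := by
    refine (hψ.const_smul ((ν / Real.pi) ^ (3 / 4 : ℝ))).mono h₁.aestronglyMeasurable
      (ae_of_all _ fun x => ?_)
    rw [norm_smul, Pi.smul_apply, norm_smul]
    gcongr
    exact (norm_kernelModulus_le hν u x).trans (le_abs_self _)
  simp_rw [enorm_weighted_bargmannTransform]
  rw [lintegral_enorm_integral_cexp_smul_sq h₁ h₂ (k := ν * √2) (by positivity),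
    ← lintegral_const_mul' _ _ ENNReal.ofReal_ne_top]
  simp_rw [enorm_smul, mul_pow, mul_assoc]

lemma continuous_weighted_bargmannTransform (hν : 0 < ν) (hψ : MemLp ψ 2) :
    Continuous (weighted ν (bargmannTransform ν ψ : ℂ → F)) := by
  have hB : Continuous (bargmannTransform ν ψ : ℂ → F) :=
    (differentiable_bargmannTransform ℂ hν hψ).continuous
  unfold weighted
  fun_prop

theorem lintegral_enorm_weighted_bargmannTransform_sq (hν : 0 < ν) (hψ : MemLp ψ 2) :
    ∫⁻ z : ℂ, ‖weighted ν (bargmannTransform ν ψ) z‖ₑ ^ 2 = ∫⁻ x, ‖ψ x‖ₑ ^ 2 := by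
  have hmeas : Measurable fun z : ℂ => ‖weighted ν (bargmannTransform ν ψ) z‖ₑ ^ 2 :=
    (continuous_weighted_bargmannTransform hν hψ).enorm.measurable.pow_const 2
  have hmeas' : AEMeasurable (fun p : ℝ × ℝ => ENNReal.ofReal (2 * Real.pi / (ν * √2)) *
      ‖kernelModulus ν p.1 p.2‖ₑ ^ 2 * ‖ψ p.2‖ₑ ^ 2) (volume.prod volume) := by
    have hk : Measurable fun p : ℝ × ℝ => ‖kernelModulus ν p.1 p.2‖ₑ := by
      unfold kernelModulus
      fun_prop
    exact ((hk.pow_const 2).const_mul _).aemeasurable.mul (hψ.1.comp_snd.enorm.pow_const 2)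
  calc ∫⁻ z : ℂ, ‖weighted ν (bargmannTransform ν ψ) z‖ₑ ^ 2
      = ∫⁻ u : ℝ, ∫⁻ v : ℝ, ‖weighted ν (bargmannTransform ν ψ) ⟨u, v⟩‖ₑ ^ 2 := by
        rw [← Complex.volume_preserving_equiv_real_prod.symm.lintegral_comp hmeas,
          Measure.volume_eq_prod]
        exact lintegral_prod _
          (hmeas.comp Complex.measurableEquivRealProd.symm.measurable).aemeasurable
    _ = ∫⁻ u : ℝ, ∫⁻ x : ℝ, ENNReal.ofReal (2 * Real.pi / (ν * √2)) *
          ‖kernelModulus ν u x‖ₑ ^ 2 * ‖ψ x‖ₑ ^ 2 :=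
        lintegral_congr fun u => lintegral_enorm_weighted_bargmannTransform_vertical hν hψ u
    _ = ∫⁻ x : ℝ, ∫⁻ u : ℝ, ENNReal.ofReal (2 * Real.pi / (ν * √2)) *
          ‖kernelModulus ν u x‖ₑ ^ 2 * ‖ψ x‖ₑ ^ 2 := lintegral_lintegral_swap hmeas'
    _ = ∫⁻ x, ‖ψ x‖ₑ ^ 2 := by
        refine lintegral_congr fun x => ?_
        have hk : Measurable fun u : ℝ => ‖kernelModulus ν u x‖ₑ := by
          unfold kernelModulus
          fun_prop
        rw [lintegral_mul_const _ ((hk.pow_const 2).const_mul _),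
          lintegral_enorm_kernelModulus_sq hν, one_mul]

theorem eLpNorm_weighted_bargmannTransform (hν : 0 < ν) (hψ : MemLp ψ 2) :
    eLpNorm (weighted ν (bargmannTransform ν ψ : ℂ → F)) 2 volume = eLpNorm ψ 2 volume := by
  have h := lintegral_enorm_weighted_bargmannTransform_sq hν hψ
  rw [lintegral_enorm_sq_eq_eLpNorm_sq, lintegral_enorm_sq_eq_eLpNorm_sq] at h
  exact ENNReal.rpow_left_injective two_ne_zero (by simpa only [ENNReal.rpow_two] using h)

theorem memLp_two_weighted_bargmannTransform (hν : 0 < ν) (hψ : MemLp ψ 2) :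
    MemLp (weighted ν (bargmannTransform ν ψ : ℂ → F)) 2 :=
  ⟨(continuous_weighted_bargmannTransform hν hψ).aestronglyMeasurable,
    (eLpNorm_weighted_bargmannTransform hν hψ).trans_lt hψ.2⟩

end WeightedTransform

section MeanValue

variable {F : Type*} [NormedAddCommGroup F]

lemma measurePreserving_circle_mul :
    MeasurePreserving (fun p : ℝ × ℂ => (p.1, circleMap 0 1 p.1 * p.2))
      ((volume.restrict (Set.uIoc 0 (2 * Real.pi))).prod volume)
      ((volume.restrict (Set.uIoc 0 (2 * Real.pi))).prod volume) := by
  have hmul : Measurable (Function.uncurry fun (θ : ℝ) (z : ℂ) => circleMap 0 1 θ * z) :=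
    (((continuous_circleMap 0 1).comp continuous_fst).mul continuous_snd).measurable
  refine (MeasurePreserving.id _).skew_product hmul (ae_of_all _ fun θ => ?_)
  have hrotation : (fun z => circleMap 0 1 θ * z) = rotation (Circle.exp θ) := by
    funext z
    simp [circleMap]
  exact hrotation ▸ (rotation (Circle.exp θ)).measurePreserving.map_eq

lemma integral_circleAverage_mul [NormedSpace ℝ F] [CompleteSpace F] {H : ℂ → F}
    (hH : Integrable H) :
    ∫ z, Real.circleAverage (fun t => H (t * z)) 0 1 = ∫ z, H z := by
  have rotate (θ : ℝ) : ∫ z, H (circleMap 0 1 θ * z) = ∫ z, H z := by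
    simpa [circleMap] using (rotation (Circle.exp θ)).measurePreserving.integral_comp
      (rotation (Circle.exp θ)).toHomeomorph.measurableEmbedding H
  have hint : Integrable (Function.uncurry fun (θ : ℝ) (z : ℂ) => H (circleMap 0 1 θ * z))
      ((volume.restrict (Set.uIoc 0 (2 * Real.pi))).prod volume) := by
    have : IsFiniteMeasure (volume.restrict (Set.uIoc 0 (2 * Real.pi))) := by
      rw [Set.uIoc_of_le Real.two_pi_pos.le]
      infer_instance
    exact measurePreserving_circle_mul.integrable_comp_of_integrable (hH.comp_snd _)
  simp only [Real.circleAverage_def]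
  rw [integral_smul, ← intervalIntegral_integral_swap hint]
  rw [intervalIntegral.integral_congr fun θ _ => rotate θ, intervalIntegral.integral_const,
    sub_zero]
  exact inv_smul_smul₀ Real.two_pi_pos.ne' _

variable [NormedSpace ℂ F] [CompleteSpace F] {ν : ℝ}

theorem integral_gaussian_smul_of_differentiable (hν : 0 < ν) {h : ℂ → F}
    (hd : Differentiable ℂ h) (hi : Integrable fun z => Real.exp (-ν * ‖z‖ ^ 2) • h z) :
    ∫ z, Real.exp (-ν * ‖z‖ ^ 2) • h z = (Real.pi / ν) • h 0 := by
  have hmean (z : ℂ) : Real.circleAverage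
      (fun t => Real.exp (-ν * ‖t * z‖ ^ 2) • h (t * z)) 0 1
      = Real.exp (-ν * ‖z‖ ^ 2) • h 0 := by
    have hdz : Differentiable ℂ fun t => h (t * z) := by fun_prop
    calc Real.circleAverage (fun t => Real.exp (-ν * ‖t * z‖ ^ 2) • h (t * z)) 0 1
        = Real.circleAverage (fun t => Real.exp (-ν * ‖z‖ ^ 2) • h (t * z)) 0 1 := by
          refine Real.circleAverage_congr_sphere fun t ht => ?_
          simp_all
      _ = Real.exp (-ν * ‖z‖ ^ 2) • Real.circleAverage (fun t => h (t * z)) 0 1 :=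
          Real.circleAverage_fun_smul
      _ = Real.exp (-ν * ‖z‖ ^ 2) • h 0 := by
          rw [hdz.diffContOnCl.circleAverage, zero_mul]
  rw [← integral_circleAverage_mul hi]
  simp only [hmean]
  rw [integral_smul_const, GaussianFourier.integral_rexp_neg_mul_sq_norm hν]
  simp

end MeanValue

section Reproducing

variable {F : Type*} [NormedAddCommGroup F] [NormedSpace ℂ F] {ν : ℝ} {g : ℂ → F}

lemma memLp_two_weighted_exp_conj (hν : 0 < ν) (w : ℂ) :
    MemLp (weighted ν fun z => Complex.exp (ν * (starRingEnd ℂ z * w))) 2 := by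
  refine (memLp_two_exp_mul_norm_sub_sq (V := ℂ) (half_pos hν) (ν * ‖w‖)).mono
    (by unfold weighted; fun_prop) (ae_of_all _ fun z => ?_)
  have hre : (ν * (starRingEnd ℂ z * w)).re ≤ ν * (‖z‖ * ‖w‖) := by
    refine (Complex.re_le_norm _).trans ?_
    simp [abs_of_pos hν]
  rw [weighted, norm_smul, Real.norm_of_nonneg (Real.exp_pos _).le,
    Real.norm_of_nonneg (Real.exp_pos _).le, Complex.norm_exp, ← Real.exp_add, Real.exp_le_exp]
  linarith

lemma weighted_smul_weighted (ν : ℝ) (f : ℂ → ℂ) (g : ℂ → F) (z : ℂ) :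
    weighted ν f z • weighted ν g z = Real.exp (-ν * ‖z‖ ^ 2) • f z • g z := by
  rw [weighted, weighted, smul_assoc, smul_comm (f z), smul_smul, ← Real.exp_add]
  congr 2
  ring

theorem integral_gaussian_smul_exp_conj_smul [CompleteSpace F] (hν : 0 < ν)
    (hd : Differentiable ℂ g) (hg : MemLp (weighted ν g) 2) (w : ℂ) :
    ∫ z, Real.exp (-ν * ‖z‖ ^ 2) • Complex.exp (ν * (starRingEnd ℂ z * w)) • g z
      = (Real.pi / ν) • g w := by
  set T : ℂ → F := fun z =>
    Real.exp (-ν * ‖z‖ ^ 2) • Complex.exp (ν * (starRingEnd ℂ z * w)) • g z with hT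
  set h : ℂ → F := fun z => Complex.exp (-ν * (z * starRingEnd ℂ w)) • g (z + w) with hh
  have hTi : Integrable T := by
    refine (memLp_one_iff_integrable.1 (hg.smul (memLp_two_weighted_exp_conj hν w))).congr
      (ae_of_all _ fun z => ?_)
    exact weighted_smul_weighted ν _ g z
  have translate (z : ℂ) : T (z + w) = Real.exp (-ν * ‖z‖ ^ 2) • h z := by
    have hexp : (Real.exp (-ν * ‖z + w‖ ^ 2) : ℂ) *
        Complex.exp (ν * (starRingEnd ℂ (z + w) * w))
        = Real.exp (-ν * ‖z‖ ^ 2) * Complex.exp (-ν * (z * starRingEnd ℂ w)) := by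
      rw [Complex.ofReal_exp, Complex.ofReal_exp, ← Complex.exp_add, ← Complex.exp_add]
      congr 1
      push_cast
      rw [← Complex.mul_conj', ← Complex.mul_conj', map_add]
      ring
    simp only [hT, hh, ← Complex.coe_smul, smul_smul, hexp]
  have hhi : Integrable fun z => Real.exp (-ν * ‖z‖ ^ 2) • h z := by
    simpa only [translate] using hTi.comp_add_right w
  rw [← integral_add_right_eq_self T w]
  simp only [translate]
  rw [integral_gaussian_smul_of_differentiable hν (by fun_prop) hhi]
  simp [hh]

theorem integral_bargmannKernel_mul (hν : 0 < ν) (z w : ℂ) :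
    ∫ x : ℝ, bargmannKernel ν z x * bargmannKernel ν w x
      = (ν / Real.pi : ℝ) * Complex.exp (ν * (z * w)) := by
  have hν' : (ν : ℂ) ≠ 0 := by exact_mod_cast hν.ne'
  have hsqrt : ((√2 : ℝ) : ℂ) ^ 2 = 2 := by rw [← Complex.ofReal_pow]; simp
  have hproduct (x : ℝ) : bargmannKernel ν z x * bargmannKernel ν w x
      = ((ν / Real.pi) ^ (3 / 2 : ℝ) : ℝ) *
        Complex.exp (-(ν : ℂ) * x ^ 2 + (ν * √2 * (z + w)) * x + -(ν / 2) * (z ^ 2 + w ^ 2)) := by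
    have hpow : (ν / Real.pi) ^ (3 / 4 : ℝ) * (ν / Real.pi) ^ (3 / 4 : ℝ)
        = (ν / Real.pi) ^ (3 / 2 : ℝ) := by
      rw [← Real.rpow_add (by positivity)]
      norm_num
    simp only [bargmannKernel, ← Complex.exp_eq_exp_ℂ]
    rw [smul_mul_smul_comm, hpow, ← Complex.exp_add, Complex.real_smul]
    congr 2
    simp only [Complex.real_smul, Complex.coe_algebraMap]
    push_cast
    ring
  have hconst : (((ν / Real.pi) ^ (3 / 2 : ℝ) : ℝ) : ℂ) * (Real.pi / ν) ^ (1 / 2 : ℂ)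
      = (ν / Real.pi : ℝ) := by
    have hcpow : ((Real.pi : ℂ) / ν) ^ (1 / 2 : ℂ) = ((Real.pi / ν) ^ (1 / 2 : ℝ) : ℝ) := by
      rw [Complex.ofReal_cpow (by positivity)]
      push_cast
      rfl
    rw [hcpow, ← Complex.ofReal_mul, ← inv_div ν Real.pi, Real.inv_rpow (by positivity),
      ← div_eq_mul_inv, ← Real.rpow_sub (by positivity)]
    norm_num
  simp_rw [hproduct]
  rw [integral_const_mul, integral_cexp_quadratic (by simpa using hν), ← mul_assoc, neg_neg,
    hconst]
  congr 2
  field_simp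
  linear_combination (2 * (z + w) ^ 2) * hsqrt

end Reproducing

section Isometry

variable {F : Type*} [NormedAddCommGroup F] [InnerProductSpace ℂ F] {ν : ℝ}

lemma norm_bargmannKernel (hν : 0 < ν) (z : ℂ) (x : ℝ) :
    ‖bargmannKernel ν z x‖ = Real.exp (ν / 2 * ‖z‖ ^ 2) * kernelModulus ν z.re x := by
  rw [← norm_weighted_bargmannKernel hν, weighted, norm_smul,
    Real.norm_of_nonneg (Real.exp_pos _).le, ← mul_assoc, ← Real.exp_add]
  simp

lemma memLp_two_bargmannKernel (hν : 0 < ν) (z : ℂ) : MemLp (bargmannKernel ν z) 2 := by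
  refine ((memLp_two_kernelModulus hν z.re).const_mul (Real.exp (ν / 2 * ‖z‖ ^ 2))).mono
    ((continuous_bargmannKernel ν).comp (Continuous.prodMk_right z)).aestronglyMeasurable
    (ae_of_all _ fun x => ?_)
  rw [norm_bargmannKernel hν]
  exact le_abs_self _

lemma memLp_two_bargmannKernel_smul (hν : 0 < ν) (z : ℂ) (e : F) :
    MemLp (fun x => bargmannKernel ν z x • e) 2 :=
  (ContinuousLinearMap.toSpanSingleton ℂ e).comp_memLp' (memLp_two_bargmannKernel hν z)

lemma inner_weighted_smul_weighted (ν : ℝ) (k : ℂ → ℂ) (e : F) (d : ℂ → F) (z : ℂ) :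
    inner ℂ (weighted ν (fun w => k w • e) z) (weighted ν d z)
      = inner ℂ e (Real.exp (-ν * ‖z‖ ^ 2) • starRingEnd ℂ (k z) • d z) := by
  rw [← weighted_smul_weighted ν (fun w => starRingEnd ℂ (k w)) d z]
  simp only [weighted, ← Complex.coe_smul, inner_smul_left, inner_smul_right, Complex.conj_ofReal,
    smul_eq_mul]
  ring

variable [CompleteSpace F]

/-- The Segal-Bargmann transform as an isometry into `L²(ℂ)`: the transform multiplied by the
square root of the Gaussian weight. -/
def bargmann (hν : 0 < ν) : Lp F 2 (volume : Measure ℝ) →ₗᵢ[ℂ] Lp F 2 (volume : Measure ℂ) where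
  toFun ψ := (memLp_two_weighted_bargmannTransform hν (Lp.memLp ψ)).toLp
  map_add' φ ψ := by
    rw [← MemLp.toLp_add]
    refine MemLp.toLp_congr _ _ (.of_eq ?_)
    rw [bargmannTransform_congr_ae ν (Lp.coeFn_add φ ψ),
      bargmannTransform_add hν (Lp.memLp φ) (Lp.memLp ψ), weighted_add]
  map_smul' c ψ := by
    rw [RingHom.id_apply, ← MemLp.toLp_const_smul]
    refine MemLp.toLp_congr _ _ (.of_eq (funext fun z => ?_))
    rw [bargmannTransform_congr_ae ν (Lp.coeFn_smul c ψ),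
      bargmannTransform_smul hν c (Lp.memLp ψ), Pi.smul_apply]
    exact smul_comm _ _ _
  norm_map' ψ := by
    change ‖(memLp_two_weighted_bargmannTransform hν (Lp.memLp ψ)).toLp‖ = ‖ψ‖
    rw [Lp.norm_toLp, eLpNorm_weighted_bargmannTransform hν (Lp.memLp ψ), Lp.norm_def]

lemma coeFn_bargmann (hν : 0 < ν) (ψ : Lp F 2 (volume : Measure ℝ)) :
    bargmann hν ψ =ᵐ[volume] weighted ν (bargmannTransform ν ψ) :=
  (memLp_two_weighted_bargmannTransform hν (Lp.memLp ψ)).coeFn_toLp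

lemma bargmann_toLp (hν : 0 < ν) {ψ : ℝ → F} (hψ : MemLp ψ 2) :
    bargmann hν hψ.toLp = (memLp_two_weighted_bargmannTransform hν hψ).toLp := by
  refine MemLp.toLp_congr (memLp_two_weighted_bargmannTransform hν (Lp.memLp _)) _ (.of_eq ?_)
  rw [bargmannTransform_congr_ae ν hψ.coeFn_toLp]

lemma bargmannTransform_bargmannKernel_smul (hν : 0 < ν) (w : ℂ) (e : F) (z : ℂ) :
    bargmannTransform ν (fun x => bargmannKernel ν w x • e) z
      = ((ν / Real.pi : ℝ) * Complex.exp (ν * (z * w))) • e := by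
  simp only [bargmannTransform, smul_smul]
  rw [integral_smul_const, integral_bargmannKernel_mul hν]

variable {d : ℂ → F}

-- The transform sends `A(w̄; ·) e` to a multiple of the reproducing kernel of the Fock space.
theorem inner_bargmann_bargmannKernel_smul (hν : 0 < ν) (hd : Differentiable ℂ d)
    (hW : MemLp (weighted ν d) 2) (w : ℂ) (e : F) :
    inner ℂ (bargmann hν (memLp_two_bargmannKernel_smul hν (starRingEnd ℂ w) e).toLp) hW.toLp
      = inner ℂ e (d w) := by
  set φ : ℝ → F := fun x => bargmannKernel ν (starRingEnd ℂ w) x • e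
  have hφ : MemLp φ 2 := memLp_two_bargmannKernel_smul hν (starRingEnd ℂ w) e
  set k : ℂ → F := fun z =>
    Real.exp (-ν * ‖z‖ ^ 2) • Complex.exp (ν * (starRingEnd ℂ z * w)) • d z
  have hk : Integrable k :=
    (memLp_one_iff_integrable.1 (hW.smul (memLp_two_weighted_exp_conj hν w))).congr
      (ae_of_all _ (weighted_smul_weighted ν _ d))
  have hpointwise (z : ℂ) : inner ℂ (weighted ν (bargmannTransform ν φ) z) (weighted ν d z)
      = inner ℂ e ((ν / Real.pi) • k z) := by
    rw [funext (bargmannTransform_bargmannKernel_smul hν (starRingEnd ℂ w) e),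
      inner_weighted_smul_weighted]
    simp only [k, map_mul, Complex.conj_ofReal, ← Complex.exp_conj, Complex.conj_conj, mul_smul,
      Complex.coe_smul]
    rw [smul_comm]
  calc inner ℂ (bargmann hν hφ.toLp) hW.toLp
      = ∫ z, inner ℂ (weighted ν (bargmannTransform ν φ) z) (weighted ν d z) := by
        rw [bargmann_toLp, L2.inner_def]
        refine integral_congr_ae ?_
        filter_upwards [(memLp_two_weighted_bargmannTransform hν hφ).coeFn_toLp, hW.coeFn_toLp]
          with z hBz hWz
        rw [hBz, hWz]
    _ = inner ℂ e ((ν / Real.pi) • (Real.pi / ν) • d w) := by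
        simp only [hpointwise]
        rw [integral_inner (hk.fun_smul _), integral_smul,
          integral_gaussian_smul_exp_conj_smul hν hd hW]
    _ = inner ℂ e (d w) := by
        rw [smul_smul, div_mul_div_cancel₀ Real.pi_ne_zero, div_self hν.ne', one_smul]

theorem eq_zero_of_forall_inner_bargmann_eq_zero (hν : 0 < ν) (hd : Differentiable ℂ d)
    (hW : MemLp (weighted ν d) 2) (h : ∀ φ, inner ℂ (bargmann hν φ) hW.toLp = 0) : d = 0 :=
  funext fun w => ext_inner_left ℂ fun e => by
    rw [← inner_bargmann_bargmannKernel_smul hν hd hW, h, Pi.zero_apply, inner_zero_right]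

theorem exists_bargmannTransform_eq (hν : 0 < ν) (hd : Differentiable ℂ d)
    (hW : MemLp (weighted ν d) 2) :
    ∃ ψ : Lp F 2 (volume : Measure ℝ), bargmannTransform ν ψ = d := by
  set ψ := ContinuousLinearMap.adjoint (bargmann hν).toContinuousLinearMap hW.toLp
  have hB := memLp_two_weighted_bargmannTransform hν (Lp.memLp ψ)
  have hsub : MemLp (weighted ν (d - bargmannTransform ν ψ)) 2 := by
    rw [weighted_sub]
    exact hW.sub hB
  have horthogonal (φ : Lp F 2 (volume : Measure ℝ)) :
      inner ℂ (bargmann hν φ) hsub.toLp = 0 := by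
    have htoLp : hsub.toLp = hW.toLp - bargmann hν ψ :=
      (MemLp.toLp_congr hsub (hW.sub hB) (.of_eq (weighted_sub ν d _))).trans (MemLp.toLp_sub hW hB)
    rw [htoLp, inner_sub_right, LinearIsometry.inner_map_map,
      ContinuousLinearMap.adjoint_inner_right, LinearIsometry.coe_toContinuousLinearMap, sub_self]
  exact ⟨ψ, (sub_eq_zero.1 (eq_zero_of_forall_inner_bargmann_eq_zero hν
    (hd.sub (differentiable_bargmannTransform ℂ hν (Lp.memLp ψ))) hsub horthogonal)).symm⟩

end Isometry

section Inversion

/-- The integrand of the adjoint of `bargmann` applied to `W : ℂ → E`; the adjoint itself is an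
integral over `ℂ` only in the mean. -/
def adjointIntegrand {E : Type*} [SMul ℂ E] (ν : ℝ) (W : ℂ → E) (x : ℝ) (z : ℂ) : E :=
  starRingEnd ℂ (weighted ν (fun w => bargmannKernel ν w x) z) • W z

/-- The adjoint of `bargmann` applied to the truncation of `W` to the disc of radius `R`. -/
def truncatedAdjoint {E : Type*} [NormedAddCommGroup E] [NormedSpace ℂ E] (ν : ℝ) (W : ℂ → E)
    (R x : ℝ) : E :=
  ∫ z in Metric.ball 0 R, adjointIntegrand ν W x z

/-- A square integrable bound for `kernelModulus ν u`, uniform in `|u| ≤ R`. -/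
def kernelMajorant (ν R x : ℝ) : ℝ :=
  (ν / Real.pi) ^ (3 / 4 : ℝ) * Real.exp (ν * √2 * R * ‖x‖ - ν / 2 * ‖x‖ ^ 2)

lemma memLp_two_kernelMajorant {ν : ℝ} (hν : 0 < ν) (R : ℝ) : MemLp (kernelMajorant ν R) 2 :=
  (memLp_two_exp_mul_norm_sub_sq (half_pos hν) (ν * √2 * R)).const_mul _

lemma kernelModulus_le_kernelMajorant {ν : ℝ} (hν : 0 < ν) {u R : ℝ} (hu : |u| ≤ R) (x : ℝ) :
    kernelModulus ν u x ≤ kernelMajorant ν R x := by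
  have hsqrt : √2 ^ 2 = 2 := by simp
  have hux : u * x ≤ R * |x| :=
    (le_abs_self _).trans ((abs_mul u x).trans_le (by gcongr))
  unfold kernelModulus kernelMajorant
  gcongr
  rw [Real.norm_eq_abs, sq_abs]
  calc -(ν / 2) * (√2 * u - x) ^ 2
      = ν * √2 * (u * x) - ν / 2 * x ^ 2 - ν * u ^ 2 := by linear_combination -ν / 2 * u ^ 2 * hsqrt
    _ ≤ ν * √2 * (u * x) - ν / 2 * x ^ 2 := sub_le_self _ (by positivity)
    _ ≤ ν * √2 * R * |x| - ν / 2 * x ^ 2 := by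
      rw [mul_assoc (ν * √2)]
      gcongr

variable {E : Type*} [NormedAddCommGroup E] [NormedSpace ℂ E] {ν : ℝ} {W : ℂ → E} {μ : Measure ℂ}

lemma norm_adjointIntegrand (hν : 0 < ν) (W : ℂ → E) (x : ℝ) (z : ℂ) :
    ‖adjointIntegrand ν W x z‖ = kernelModulus ν z.re x * ‖W z‖ := by
  rw [adjointIntegrand, norm_smul, RCLike.norm_conj, norm_weighted_bargmannKernel hν]

lemma norm_adjointIntegrand_le (hν : 0 < ν) (W : ℂ → E) (x : ℝ) {R : ℝ} {z : ℂ}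
    (hz : z ∈ Metric.ball 0 R) : ‖adjointIntegrand ν W x z‖ ≤ kernelMajorant ν R x * ‖W z‖ := by
  rw [norm_adjointIntegrand hν]
  gcongr
  exact kernelModulus_le_kernelMajorant hν
    ((Complex.abs_re_le_norm z).trans (mem_ball_zero_iff.1 hz).le) x

lemma continuous_weighted_bargmannKernel (ν : ℝ) :
    Continuous fun p : ℂ × ℝ => weighted ν (fun w => bargmannKernel ν w p.2) p.1 :=
  (by fun_prop : Continuous fun p : ℂ × ℝ => Real.exp (-(ν / 2) * ‖p.1‖ ^ 2)).smul
    (continuous_bargmannKernel ν)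

lemma aestronglyMeasurable_adjointIntegrand_prod (ν : ℝ) (hW : AEStronglyMeasurable W μ) :
    AEStronglyMeasurable (fun p : ℂ × ℝ => adjointIntegrand ν W p.2 p.1) (μ.prod volume) :=
  (Complex.continuous_conj.comp (continuous_weighted_bargmannKernel ν)).aestronglyMeasurable.smul
    hW.comp_fst

lemma integrable_adjointIntegrand (hν : 0 < ν) (hW : Integrable W μ) (x : ℝ) :
    Integrable (adjointIntegrand ν W x) μ := by
  refine (hW.norm.const_mul ((ν / Real.pi) ^ (3 / 4 : ℝ))).mono'
    ((Complex.continuous_conj.comp ((continuous_weighted_bargmannKernel ν).comp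
      (Continuous.prodMk_left x))).aestronglyMeasurable.smul hW.1) (ae_of_all _ fun z => ?_)
  rw [norm_adjointIntegrand hν]
  gcongr
  exact (le_abs_self _).trans (norm_kernelModulus_le hν _ _)

lemma integrableOn_ball_of_memLp_two {X E : Type*} [PseudoMetricSpace X] [ProperSpace X]
    [MeasurableSpace X] [NormedAddCommGroup E] {μ : Measure X} [IsFiniteMeasureOnCompacts μ]
    {g : X → E} (hg : MemLp g 2 μ) (a : X) (R : ℝ) : IntegrableOn g (Metric.ball a R) μ :=
  have : IsFiniteMeasure (μ.restrict (Metric.ball a R)) :=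
    isFiniteMeasure_restrict.2 measure_ball_lt_top.ne
  (hg.restrict _).integrable one_le_two

lemma integrableOn_adjointIntegrand (hν : 0 < ν) (hW : MemLp W 2) (R x : ℝ) :
    IntegrableOn (adjointIntegrand ν W x) (Metric.ball 0 R) :=
  integrable_adjointIntegrand hν (integrableOn_ball_of_memLp_two hW 0 R) x

lemma memLp_two_truncatedAdjoint (hν : 0 < ν) (hW : MemLp W 2) (R : ℝ) :
    MemLp (truncatedAdjoint ν W R) 2 := by
  have hball := integrableOn_ball_of_memLp_two hW 0 R
  refine ((memLp_two_kernelMajorant hν R).mul_const (∫ z in Metric.ball 0 R, ‖W z‖)).mono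
    (aestronglyMeasurable_adjointIntegrand_prod ν hball.1).prod_swap.integral_prod_right'
    (ae_of_all _ fun x => ?_)
  refine (norm_integral_le_of_norm_le (hball.norm.const_mul _) ?_).trans
    ((integral_const_mul _ _).trans_le (le_abs_self _))
  filter_upwards [ae_restrict_mem measurableSet_ball] with z hz
  exact norm_adjointIntegrand_le hν W x hz

theorem tendsto_eLpNorm_indicator_sub_of_aecover {α ι E : Type*} [MeasurableSpace α]
    [NormedAddCommGroup E] {μ : Measure α} {l : Filter ι} [l.IsCountablyGenerated] {s : ι → Set α}
    (hs : AECover μ l s) {p : ENNReal} (hp₀ : p ≠ 0) (hp : p ≠ ⊤) {g : α → E} (hg : MemLp g p μ) :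
    Tendsto (fun i => eLpNorm ((s i).indicator g - g) p μ) l (𝓝 0) := by
  have hpos := ENNReal.toReal_pos hp₀ hp
  have hzero : Tendsto (fun i => ∫⁻ x, ‖((s i).indicator g - g) x‖ₑ ^ p.toReal ∂μ) l
      (𝓝 (∫⁻ _, 0 ∂μ)) := by
    refine tendsto_lintegral_filter_of_dominated_convergence' (fun x => ‖g x‖ₑ ^ p.toReal)
      (.of_forall fun i => ((hg.1.indicator (hs.measurableSet i)).sub hg.1).enorm.pow_const _)
      (.of_forall fun i => ae_of_all _ fun x => ?_)
      (lintegral_rpow_enorm_lt_top_of_eLpNorm_lt_top hp₀ hp hg.2).ne ?_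
    · by_cases hx : x ∈ s i <;> simp [hx, ENNReal.zero_rpow_of_pos hpos]
    · filter_upwards [hs.ae_eventually_mem] with x hx
      refine tendsto_const_nhds.congr' (hx.mono fun i hi => ?_)
      simp [hi, hpos]
  simp only [lintegral_zero] at hzero
  simp only [eLpNorm_eq_lintegral_rpow_enorm_toReal hp₀ hp]
  simpa [hpos] using hzero.ennrpow_const (1 / p.toReal)

variable {F : Type*} [NormedAddCommGroup F] [InnerProductSpace ℂ F] {V : ℂ → F} {ψ : ℝ → F}

lemma inner_adjointIntegrand (ν : ℝ) (V : ℂ → F) (x : ℝ) (z : ℂ) (e : F) :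
    inner ℂ (adjointIntegrand ν V x z) e
      = inner ℂ (V z) (weighted ν (fun w => bargmannKernel ν w x) z • e) := by
  rw [adjointIntegrand, inner_smul_left, inner_smul_right, Complex.conj_conj]

lemma integrable_inner_adjointIntegrand_prod (hν : 0 < ν) (hV : MemLp V 2) (R : ℝ)
    (hψ : MemLp ψ 2) : Integrable (fun p : ℂ × ℝ => inner ℂ (adjointIntegrand ν V p.2 p.1) (ψ p.2))
      ((volume.restrict (Metric.ball 0 R)).prod volume) := by
  have hball := integrableOn_ball_of_memLp_two hV 0 R
  refine (hball.norm.mul_prod ((memLp_two_kernelMajorant hν R).integrable_mul hψ.norm)).mono'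
    ((aestronglyMeasurable_adjointIntegrand_prod ν hball.1).inner hψ.1.comp_snd) ?_
  filter_upwards [Measure.quasiMeasurePreserving_fst.ae (ae_restrict_mem measurableSet_ball)]
    with p hp
  calc ‖inner ℂ (adjointIntegrand ν V p.2 p.1) (ψ p.2)‖
      ≤ ‖adjointIntegrand ν V p.2 p.1‖ * ‖ψ p.2‖ := norm_inner_le_norm _ _
    _ ≤ kernelMajorant ν R p.2 * ‖V p.1‖ * ‖ψ p.2‖ := by
      gcongr
      exact norm_adjointIntegrand_le hν V p.2 hp
    _ = ‖V p.1‖ * (kernelMajorant ν R p.2 * ‖ψ p.2‖) := by ring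

variable [CompleteSpace F]

theorem integral_inner_truncatedAdjoint (hν : 0 < ν) (hV : MemLp V 2) (R : ℝ) (hψ : MemLp ψ 2) :
    ∫ x, inner ℂ (truncatedAdjoint ν V R x) (ψ x)
      = ∫ z in Metric.ball 0 R, inner ℂ (V z) (weighted ν (bargmannTransform ν ψ) z) := by
  have hinside (x : ℝ) : inner ℂ (truncatedAdjoint ν V R x) (ψ x)
      = ∫ z in Metric.ball 0 R, inner ℂ (adjointIntegrand ν V x z) (ψ x) := by
    rw [← inner_conj_symm, truncatedAdjoint,
      ← integral_inner (integrableOn_adjointIntegrand hν hV R x), ← integral_conj]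
    simp only [inner_conj_symm]
  have hoverlap (z : ℂ) : ∫ x, inner ℂ (adjointIntegrand ν V x z) (ψ x)
      = inner ℂ (V z) (weighted ν (bargmannTransform ν ψ) z) := by
    have hint : Integrable fun x => weighted ν (fun w => bargmannKernel ν w x) z • ψ x := by
      simp only [weighted, smul_assoc]
      exact (integrable_bargmannKernel_smul hν hψ z).fun_smul _
    simp only [inner_adjointIntegrand]
    rw [integral_inner hint, weighted_bargmannTransform]
  simp only [hinside]
  rw [integral_integral_swap
    (f := fun (x : ℝ) (z : ℂ) => inner ℂ (adjointIntegrand ν V x z) (ψ x))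
    (integrable_inner_adjointIntegrand_prod hν hV R hψ).swap]
  simp only [hoverlap]

theorem adjoint_bargmann_toLp_indicator (hν : 0 < ν) (hV : MemLp V 2) (R : ℝ) :
    ContinuousLinearMap.adjoint (bargmann hν).toContinuousLinearMap
        (hV.indicator (measurableSet_ball (x := 0) (ε := R))).toLp
      = (memLp_two_truncatedAdjoint hν hV R).toLp := by
  have hind := hV.indicator (measurableSet_ball (x := 0) (ε := R))
  refine ext_inner_right ℂ fun φ => ?_
  rw [ContinuousLinearMap.adjoint_inner_left, L2.inner_def, L2.inner_def]
  calc ∫ z, inner ℂ (hind.toLp _ z) (bargmann hν φ z)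
      = ∫ z, (Metric.ball 0 R).indicator
          (fun z => inner ℂ (V z) (weighted ν (bargmannTransform ν φ) z)) z := by
        refine integral_congr_ae ?_
        filter_upwards [hind.coeFn_toLp, coeFn_bargmann hν φ] with z hVz hBz
        rw [hVz, hBz]
        by_cases hz : z ∈ Metric.ball (0 : ℂ) R <;> simp [hz]
    _ = ∫ x, inner ℂ (truncatedAdjoint ν V R x) (φ x) := by
        rw [integral_indicator measurableSet_ball,
          integral_inner_truncatedAdjoint hν hV R (Lp.memLp φ)]
    _ = ∫ x, inner ℂ ((memLp_two_truncatedAdjoint hν hV R).toLp _ x) (φ x) := by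
        refine integral_congr_ae ?_
        filter_upwards [(memLp_two_truncatedAdjoint hν hV R).coeFn_toLp] with x hx
        rw [hx]

theorem eLpNorm_truncatedAdjoint_sub_le (hν : 0 < ν) (hψ : MemLp ψ 2) (R : ℝ) :
    eLpNorm (truncatedAdjoint ν (weighted ν (bargmannTransform ν ψ)) R - ψ) 2 volume
      ≤ eLpNorm ((Metric.ball 0 R).indicator (weighted ν (bargmannTransform ν ψ))
        - weighted ν (bargmannTransform ν ψ)) 2 volume := by
  set A := ContinuousLinearMap.adjoint
    (bargmann hν : Lp F 2 (volume : Measure ℝ) →ₗᵢ[ℂ] _).toContinuousLinearMap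
  have hW := memLp_two_weighted_bargmannTransform hν hψ
  have hind := hW.indicator (measurableSet_ball (x := 0) (ε := R))
  have hA : A hW.toLp = hψ.toLp := by
    refine ext_inner_right ℂ fun φ => ?_
    rw [← bargmann_toLp hν, ContinuousLinearMap.adjoint_inner_left,
      LinearIsometry.coe_toContinuousLinearMap, LinearIsometry.inner_map_map]
  have hnorm : ‖A‖ ≤ 1 :=
    (LinearIsometryEquiv.norm_map _ _).trans_le (LinearIsometry.norm_toContinuousLinearMap_le _)
  calc eLpNorm (truncatedAdjoint ν (weighted ν (bargmannTransform ν ψ)) R - ψ) 2 volume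
      = ‖A (hind.sub hW).toLp‖ₑ := by
        rw [MemLp.toLp_sub hind hW, map_sub, adjoint_bargmann_toLp_indicator hν hW, hA,
          ← MemLp.toLp_sub, Lp.enorm_toLp]
    _ ≤ ‖(hind.sub hW).toLp‖ₑ := by
        rw [← ofReal_norm, ← ofReal_norm]
        exact ENNReal.ofReal_le_ofReal ((A.le_of_opNorm_le hnorm _).trans_eq (one_mul _))
    _ = _ := Lp.enorm_toLp _

theorem tendsto_eLpNorm_truncatedAdjoint_sub (hν : 0 < ν) (hψ : MemLp ψ 2) :
    Tendsto (fun R => eLpNorm (truncatedAdjoint ν (weighted ν (bargmannTransform ν ψ)) R - ψ) 2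
      volume) atTop (𝓝 0) :=
  tendsto_of_tendsto_of_tendsto_of_le_of_le tendsto_const_nhds
    (tendsto_eLpNorm_indicator_sub_of_aecover (aecover_ball tendsto_id) two_ne_zero
      ENNReal.ofNat_ne_top (memLp_two_weighted_bargmannTransform hν hψ))
    (fun _ => zero_le) (eLpNorm_truncatedAdjoint_sub_le hν hψ)

theorem ae_eq_integral_adjointIntegrand (hν : 0 < ν) (hψ : MemLp ψ 2) :
    ∀ᵐ x, Integrable (adjointIntegrand ν (weighted ν (bargmannTransform ν ψ)) x) →
      ψ x = ∫ z, adjointIntegrand ν (weighted ν (bargmannTransform ν ψ)) x z := by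
  have hW := memLp_two_weighted_bargmannTransform hν hψ
  obtain ⟨r, hr, hae⟩ := (tendstoInMeasure_of_tendsto_eLpNorm two_ne_zero
    (fun R => (memLp_two_truncatedAdjoint hν hW R).1) hψ.1
    (tendsto_eLpNorm_truncatedAdjoint_sub hν hψ)).exists_seq_tendsto_ae'
  filter_upwards [hae] with x hx hint
  exact tendsto_nhds_unique hx
    ((aecover_ball hr).integral_tendsto_of_countably_generated hint)

end Inversion

section Slice

variable {I : ℍ}

lemma norm_eq_one_of_sq_eq_neg_one (hI : I ^ 2 = -1) : ‖I‖ = 1 := by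
  have hsq : ‖I‖ ^ 2 = 1 := by rw [← norm_pow, hI, norm_neg, norm_one]
  exact (pow_eq_one_iff_of_nonneg (norm_nonneg I) two_ne_zero).1 hsq

lemma star_eq_neg_of_sq_eq_neg_one (hI : I ^ 2 = -1) : star I = -I := by
  refine Quaternion.star_eq_neg.2 (Quaternion.sq_eq_neg_normSq.1 ?_)
  rw [hI, Quaternion.normSq_eq_norm_mul_self, norm_eq_one_of_sq_eq_neg_one hI]
  simp

/-- `sliceMap I` as a homomorphism of real Banach algebras. -/
def sliceHom (hI : I ^ 2 = -1) : ℂ →A[ℝ] ℍ where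
  toAlgHom := Complex.liftAux I (by rw [← pow_two, hI])
  cont := (Complex.liftAux I (by rw [← pow_two, hI])).toLinearMap.continuous_of_finiteDimensional

lemma sliceHom_apply (hI : I ^ 2 = -1) (z : ℂ) : sliceHom hI z = sliceMap I z := by
  change Complex.liftAux I (by rw [← pow_two, hI]) z = _
  simp [Complex.liftAux_apply, sliceMap, Quaternion.coe_mul_eq_smul]

lemma sliceMap_mul (hI : I ^ 2 = -1) (z w : ℂ) :
    sliceMap I (z * w) = sliceMap I z * sliceMap I w := by
  simp only [← sliceHom_apply hI, map_mul]

lemma sliceMap_ofReal (I : ℍ) (r : ℝ) : sliceMap I r = r := by simp [sliceMap]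

lemma sliceMap_I (I : ℍ) : sliceMap I Complex.I = I := by simp [sliceMap]

lemma star_sliceMap (hI : I ^ 2 = -1) (z : ℂ) :
    star (sliceMap I z) = sliceMap I (starRingEnd ℂ z) := by
  simp [sliceMap, star_eq_neg_of_sq_eq_neg_one hI, Quaternion.coe_mul_eq_smul]

lemma norm_sliceMap (hI : I ^ 2 = -1) (z : ℂ) : ‖sliceMap I z‖ = ‖z‖ := by
  have hsq : ((‖sliceMap I z‖ ^ 2 : ℝ) : ℍ) = ((‖z‖ ^ 2 : ℝ) : ℍ) := by
    rw [pow_two, ← Quaternion.normSq_eq_norm_mul_self, ← Quaternion.self_mul_star,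
      star_sliceMap hI, ← sliceMap_mul hI, Complex.mul_conj', ← Complex.ofReal_pow, sliceMap_ofReal]
  exact (pow_left_inj₀ (norm_nonneg _) (norm_nonneg _) two_ne_zero).1 (Quaternion.coe_injective hsq)

lemma exists_sq_eq_neg_one : ∃ J : ℍ, J ^ 2 = -1 := by
  refine ⟨(Quaternion.equivTuple ℝ).symm ![0, 1, 0, 0], ?_⟩
  rw [Quaternion.sq_eq_neg_normSq.2 (by simp), Quaternion.normSq_def']
  simp

lemma exists_eq_sliceMap (q : ℍ) : ∃ J : ℍ, J ^ 2 = -1 ∧ ∃ z : ℂ, q = sliceMap J z := by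
  by_cases him : q.im = 0
  · obtain ⟨J, hJ⟩ := exists_sq_eq_neg_one
    refine ⟨J, hJ, q.re, ?_⟩
    rw [sliceMap_ofReal, ← Quaternion.re_add_im q, him, add_zero, Quaternion.re_coe]
  · have hnorm : ‖q.im‖ ≠ 0 := norm_ne_zero_iff.2 him
    refine ⟨‖q.im‖⁻¹ • q.im, ?_, ⟨q.re, ‖q.im‖⟩, ?_⟩
    · rw [smul_pow, Quaternion.sq_eq_neg_normSq.2 (Quaternion.re_im q),
        Quaternion.normSq_eq_norm_mul_self, smul_neg, ← Quaternion.coe_smul, smul_eq_mul,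
        ← pow_two, ← mul_pow, inv_mul_cancel₀ hnorm, one_pow, Quaternion.coe_one]
    · simp only [sliceMap, Quaternion.coe_mul_eq_smul, smul_smul]
      rw [mul_inv_cancel₀ hnorm, one_smul, Quaternion.re_add_im]

lemma kernel_sliceMap (hI : I ^ 2 = -1) (ν : ℝ) (z : ℂ) (x : ℝ) :
    kernel ν (sliceMap I z) x = sliceMap I (bargmannKernel ν z x) := by
  rw [kernel_eq_bargmannKernel, ← sliceHom_apply hI, ← sliceHom_apply hI, map_bargmannKernel]

lemma inner_mul_left (a p q : ℍ) : inner ℝ (a * p) q = inner ℝ p (star a * q) := by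
  simp only [Quaternion.inner_def, star_mul, star_star, mul_assoc]
  simp [Quaternion.re_mul]
  ring

end Slice

section SliceSpace

variable {I : ℍ}

/-- The quaternions as a complex Hilbert space, on which `x + iy` acts by left multiplication by
`x + yI` and whose norm is that of `ℍ`. It is a type synonym, since the left multiplications and
hence the complex structures differ from slice to slice. -/
def SliceSpace (_hI : I ^ 2 = -1) : Type := ℍ

variable (hI : I ^ 2 = -1)

instance : NormedAddCommGroup (SliceSpace hI) := inferInstanceAs (NormedAddCommGroup ℍ)

instance : CompleteSpace (SliceSpace hI) := inferInstanceAs (CompleteSpace ℍ)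

instance : Module ℂ (SliceSpace hI) :=
  Module.compHom ℍ (sliceHom hI : ℂ →+* ℍ)

instance : NormedSpace ℂ (SliceSpace hI) where
  norm_smul_le z (q : ℍ) := by
    change ‖sliceHom hI z * q‖ ≤ ‖z‖ * ‖q‖
    rw [norm_mul, sliceHom_apply, norm_sliceMap hI]

/-- The identity map, as an isometry. -/
def toSliceSpace : ℍ ≃ₗᵢ[ℝ] SliceSpace hI where
  toFun q := q
  invFun q := q
  map_add' _ _ := rfl
  map_smul' r (q : ℍ) := by
    change (r • q : ℍ) = sliceHom hI (r : ℂ) * q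
    rw [sliceHom_apply, sliceMap_ofReal, Quaternion.coe_mul_eq_smul]
  left_inv _ := rfl
  right_inv _ := rfl
  norm_map' _ := rfl

lemma toSliceSpace_sliceMap_mul (z : ℂ) (q : ℍ) :
    toSliceSpace hI (sliceMap I z * q) = z • toSliceSpace hI q := by
  rw [← sliceHom_apply hI]
  rfl

-- The imaginary part is forced by `Im ⟨p, q⟩ = Re ⟨i p, q⟩`.
instance : InnerProductSpace ℂ (SliceSpace hI) where
  inner p q := ⟨inner ℝ ((toSliceSpace hI).symm p) ((toSliceSpace hI).symm q),
    inner ℝ (I * (toSliceSpace hI).symm p) ((toSliceSpace hI).symm q)⟩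
  norm_sq_eq_re_inner p :=
    ((toSliceSpace hI).symm.norm_map p ▸ (real_inner_self_eq_norm_sq _).symm :)
  conj_inner_symm p q := by
    refine Complex.ext (real_inner_comm _ _) ?_
    change -inner ℝ (I * _) _ = inner ℝ (I * _) _
    rw [inner_mul_left, star_eq_neg_of_sq_eq_neg_one hI, neg_mul, inner_neg_right, neg_neg,
      real_inner_comm]
  add_left p q r := by
    refine Complex.ext ?_ ?_ <;> simp [mul_add, inner_add_left]
  smul_left p q z := by
    obtain ⟨p, rfl⟩ := (toSliceSpace hI).surjective p
    rw [← toSliceSpace_sliceMap_mul]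
    have hII : I * (I * p) = -p := by rw [← mul_assoc, ← pow_two, hI, neg_one_mul]
    refine Complex.ext ?_ ?_ <;>
    simp [sliceMap, Quaternion.coe_mul_eq_smul, add_mul, mul_add, inner_add_left,
      real_inner_smul_left, hII]

/-- The restriction of `f` to the slice `ℂ_I`, as a vector-valued function of a complex variable:
slice regularity is complex differentiability of all these restrictions. -/
def restrictSlice (f : ℍ → ℍ) (z : ℂ) : SliceSpace hI := toSliceSpace hI (f (sliceMap I z))

end SliceSpace

section SliceRegular

lemma hasDerivAt_complexMk_re (x y : ℝ) : HasDerivAt (fun s : ℝ => (⟨s, y⟩ : ℂ)) 1 x := by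
  have hmk : (fun s : ℝ => (⟨s, y⟩ : ℂ)) = fun s : ℝ => (s : ℂ) + y * Complex.I :=
    funext fun s => Complex.mk_eq_add_mul_I s y
  rw [hmk]
  exact Complex.ofRealCLM.hasDerivAt.add_const _

lemma hasDerivAt_complexMk_im (x y : ℝ) :
    HasDerivAt (fun t : ℝ => (⟨x, t⟩ : ℂ)) Complex.I y := by
  have hmk : (fun t : ℝ => (⟨x, t⟩ : ℂ)) = fun t : ℝ => (x : ℂ) + t * Complex.I :=
    funext fun t => Complex.mk_eq_add_mul_I x t
  rw [hmk]
  simpa using (Complex.ofRealCLM.hasDerivAt.mul_const Complex.I).const_add (x : ℂ)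

lemma deriv_add_I_smul_deriv_eq_zero_iff {E : Type*} [NormedAddCommGroup E] [NormedSpace ℂ E]
    {g : ℂ → E} {z : ℂ} (hg : DifferentiableAt ℝ g z) :
    deriv (fun s : ℝ => g ⟨s, z.im⟩) z.re + Complex.I • deriv (fun t : ℝ => g ⟨z.re, t⟩) z.im = 0 ↔
      DifferentiableAt ℂ g z := by
  have hx : HasDerivAt (fun s : ℝ => g ⟨s, z.im⟩) (fderiv ℝ g z 1) z.re :=
    hg.hasFDerivAt.comp_hasDerivAt (f := fun s : ℝ => (⟨s, z.im⟩ : ℂ)) z.re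
      (hasDerivAt_complexMk_re _ _)
  have hy : HasDerivAt (fun t : ℝ => g ⟨z.re, t⟩) (fderiv ℝ g z Complex.I) z.im :=
    hg.hasFDerivAt.comp_hasDerivAt (f := fun t : ℝ => (⟨z.re, t⟩ : ℂ)) z.im
      (hasDerivAt_complexMk_im _ _)
  rw [differentiableAt_complex_iff_differentiableAt_real, hx.deriv, hy.deriv, and_iff_right hg,
    ← (smul_right_injective E Complex.I_ne_zero).eq_iff, smul_add, smul_smul, Complex.I_mul_I,
    neg_one_smul, smul_zero, ← sub_eq_add_neg, sub_eq_zero, eq_comm]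

variable {f : ℍ → ℍ} {I : ℍ} (hI : I ^ 2 = -1)

lemma dbar_eq_zero_iff (hf : Differentiable ℝ fun z => f (sliceMap I z)) :
    (∀ x y : ℝ, (1 / 2 : ℝ) • (deriv (fun s : ℝ => f (sliceMap I ⟨s, y⟩)) x
      + I * deriv (fun t : ℝ => f (sliceMap I ⟨x, t⟩)) y) = 0) ↔
      Differentiable ℂ (restrictSlice hI f) := by
  have hg : Differentiable ℝ (restrictSlice hI f) :=
    (toSliceSpace hI).toContinuousLinearEquiv.differentiable.comp hf
  have hderiv (c : ℝ → ℂ) (t : ℝ) : deriv (fun s => restrictSlice hI f (c s)) t =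
      toSliceSpace hI (deriv (fun s => f (sliceMap I (c s))) t) :=
    DFunLike.congr_fun (toSliceSpace hI).toContinuousLinearEquiv.comp_fderiv 1
  have hiff (z : ℂ) := deriv_add_I_smul_deriv_eq_zero_iff (hg z)
  simp only [hderiv, ← toSliceSpace_sliceMap_mul, sliceMap_I, ← map_add,
    LinearIsometryEquiv.map_eq_zero_iff] at hiff
  simp only [smul_eq_zero_iff_right (one_half_pos (α := ℝ)).ne']
  exact ⟨fun h z => (hiff z).1 (h z.re z.im), fun h x y => (hiff ⟨x, y⟩).2 (h _)⟩

lemma sliceRegular_iff : SliceRegular f ↔ Differentiable ℝ f ∧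
    ∀ (J : ℍ) (hJ : J ^ 2 = -1), Differentiable ℂ (restrictSlice hJ f) := by
  refine ⟨fun hf => ⟨hf.differentiable, fun J hJ => ?_⟩, fun ⟨hf, hslice⟩ => ⟨hf, ?_, ?_⟩⟩
  · exact (dbar_eq_zero_iff hJ ((hf.contDiff_slice J hJ).differentiable one_ne_zero)).1
      (hf.dbar_eq_zero J hJ)
  · intro J hJ
    have hC : ContDiff ℝ 1 (restrictSlice hJ f) := (hslice J hJ).contDiff.restrict_scalars ℝ
    exact (toSliceSpace hJ).symm.toContinuousLinearEquiv.contDiff.comp hC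
  · intro J hJ
    refine (dbar_eq_zero_iff hJ ?_).2 (hslice J hJ)
    exact (toSliceSpace hJ).symm.toContinuousLinearEquiv.differentiable.comp
      ((hslice J hJ).restrictScalars ℝ)

lemma SliceRegular.eq_zero_of_forall_sliceMap_eq_zero (hf : SliceRegular f)
    (h : ∀ z, f (sliceMap I z) = 0) : f = 0 := by
  funext q
  obtain ⟨J, hJ, z, rfl⟩ := exists_eq_sliceMap q
  have hanalytic : AnalyticOnNhd ℂ (restrictSlice hJ f) Set.univ :=
    fun w _ => ((sliceRegular_iff.1 hf).2 J hJ).analyticAt w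
  have hreal (r : ℝ) : restrictSlice hJ f r = 0 := by
    rw [restrictSlice, sliceMap_ofReal, ← sliceMap_ofReal I, h, map_zero]
  have hofReal : Tendsto (fun r : ℝ => (r : ℂ)) (𝓝[≠] 0) (𝓝[≠] 0) :=
    (Complex.continuous_ofReal.tendsto' 0 0 Complex.ofReal_zero).inf
      (tendsto_principal_principal.2 fun r hr => Complex.ofReal_ne_zero.2 hr)
  have hfreq : ∃ᶠ w in 𝓝[≠] (0 : ℂ), restrictSlice hJ f w = 0 :=
    hofReal.frequently (Eventually.of_forall hreal).frequently
  have hzero := congrFun (hanalytic.eq_of_frequently_eq (g := 0) analyticOnNhd_const hfreq) z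
  exact (toSliceSpace hJ).map_eq_zero_iff.1 hzero

end SliceRegular

section Fock

variable {ν : ℝ} {I : ℍ} {f : ℍ → ℍ} {ψ : ℝ → ℍ} (hI : I ^ 2 = -1)

lemma memLp_toSliceSpace_comp_iff {α : Type*} [MeasurableSpace α] {μ : Measure α} {p : ENNReal}
    {g : α → ℍ} : MemLp (toSliceSpace hI ∘ g) p μ ↔ MemLp g p μ :=
  (toSliceSpace hI).lipschitz.memLp_comp_iff_of_antilipschitz (toSliceSpace hI).antilipschitz
    (map_zero _)

lemma eLpNorm_toSliceSpace_comp {α : Type*} [MeasurableSpace α] (μ : Measure α) (p : ENNReal)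
    (g : α → ℍ) : eLpNorm (toSliceSpace hI ∘ g) p μ = eLpNorm g p μ :=
  eLpNorm_congr_norm_ae (ae_of_all _ fun _ => (toSliceSpace hI).norm_map _)

lemma weighted_restrictSlice (ν : ℝ) (f : ℍ → ℍ) :
    weighted ν (restrictSlice hI f) = toSliceSpace hI ∘ weighted ν (f ∘ sliceMap I) :=
  funext fun _ => ((toSliceSpace hI).map_smul _ _).symm

include hI in
lemma fockDensity_eq_norm_weighted_sq (ν : ℝ) (f : ℍ → ℍ) (z : ℂ) :
    fockDensity ν I f z = ‖weighted ν (f ∘ sliceMap I) z‖ ^ 2 := by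
  rw [fockDensity, norm_weighted_sq, norm_sliceMap hI, Function.comp_apply]

include hI in
lemma mem_fock_iff :
    f ∈ fock ν I ↔ SliceRegular f ∧ MemLp (weighted ν (f ∘ sliceMap I)) 2 := by
  refine and_congr_right fun hf => ?_
  have hcont : Continuous (weighted ν (f ∘ sliceMap I)) :=
    (by fun_prop : Continuous fun z : ℂ => Real.exp (-(ν / 2) * ‖z‖ ^ 2)).smul
      (hf.differentiable.continuous.comp (continuous_sliceMap I))
  rw [memLp_two_iff_integrable_sq_norm hcont.aestronglyMeasurable]
  simp only [← fockDensity_eq_norm_weighted_sq hI]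

lemma memLp_two_weighted_restrictSlice (hf : f ∈ fock ν I) :
    MemLp (weighted ν (restrictSlice hI f)) 2 := by
  rw [weighted_restrictSlice, memLp_toSliceSpace_comp_iff]
  exact ((mem_fock_iff hI).1 hf).2

lemma restrictSlice_transform (ν : ℝ) (ψ : ℝ → ℍ) :
    restrictSlice hI (transform ν ψ) = bargmannTransform ν (toSliceSpace hI ∘ ψ) := by
  funext z
  refine ((toSliceSpace hI).toContinuousLinearEquiv.integral_comp_comm _).symm.trans
    (integral_congr_ae (ae_of_all _ fun x => ?_))
  simp only [kernel_sliceMap hI]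
  exact toSliceSpace_sliceMap_mul hI _ _

theorem sliceRegular_transform (hν : 0 < ν) (hψ : MemLp ψ 2) : SliceRegular (transform ν ψ) := by
  refine sliceRegular_iff.2 ⟨?_, fun J hJ => ?_⟩
  · rw [transform_eq_bargmannTransform]
    exact differentiable_bargmannTransform ℝ hν hψ
  · rw [restrictSlice_transform]
    exact differentiable_bargmannTransform ℂ hν ((memLp_toSliceSpace_comp_iff hJ).2 hψ)

include hI in
lemma eLpNorm_weighted_transform (hν : 0 < ν) (hψ : MemLp ψ 2) :
    eLpNorm (weighted ν (transform ν ψ ∘ sliceMap I)) 2 volume = eLpNorm ψ 2 volume := by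
  rw [← eLpNorm_toSliceSpace_comp hI, ← weighted_restrictSlice, restrictSlice_transform,
    eLpNorm_weighted_bargmannTransform hν ((memLp_toSliceSpace_comp_iff hI).2 hψ),
    eLpNorm_toSliceSpace_comp]

include hI in
theorem transform_mem_fock (hν : 0 < ν) (hψ : MemLp ψ 2) : transform ν ψ ∈ fock ν I := by
  refine (mem_fock_iff hI).2 ⟨sliceRegular_transform hν hψ, ?_⟩
  rw [← memLp_toSliceSpace_comp_iff hI, ← weighted_restrictSlice, restrictSlice_transform]
  exact memLp_two_weighted_bargmannTransform hν ((memLp_toSliceSpace_comp_iff hI).2 hψ)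

include hI in
theorem exists_transform_eq (hν : 0 < ν) (hf : f ∈ fock ν I) : ∃ ψ : L2, transform ν ψ = f := by
  obtain ⟨Ψ, hΨ⟩ := exists_bargmannTransform_eq hν ((sliceRegular_iff.1 hf.1).2 I hI)
    (memLp_two_weighted_restrictSlice hI hf)
  have hcomp : toSliceSpace hI ∘ ((toSliceSpace hI).symm ∘ Ψ) = Ψ := by
    funext x
    simp
  have hψ : MemLp ((toSliceSpace hI).symm ∘ Ψ) 2 :=
    (memLp_toSliceSpace_comp_iff hI).1 (hcomp ▸ Lp.memLp Ψ)
  refine ⟨hψ.toLp, ?_⟩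
  rw [transform_eq_bargmannTransform, bargmannTransform_congr_ae ν hψ.coeFn_toLp,
    ← transform_eq_bargmannTransform]
  have hslice : restrictSlice hI (transform ν ((toSliceSpace hI).symm ∘ Ψ))
      = restrictSlice hI f := by
    rw [restrictSlice_transform, hcomp, hΨ]
  have hdiff := (sub_mem (transform_mem_fock hI hν hψ) hf).1
  exact sub_eq_zero.1 (hdiff.eq_zero_of_forall_sliceMap_eq_zero fun z =>
    sub_eq_zero.2 ((toSliceSpace hI).injective (congrFun hslice z)))

end Fock

section InverseIntegral

variable {ν : ℝ} {I : ℍ} (hI : I ^ 2 = -1)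

lemma conj_weighted_bargmannKernel (ν : ℝ) (z : ℂ) (x : ℝ) :
    starRingEnd ℂ (weighted ν (fun w => bargmannKernel ν w x) z)
      = weighted ν (fun w => bargmannKernel ν (starRingEnd ℂ w) x) z := by
  have hconj : starRingEnd ℂ (bargmannKernel ν z x) = bargmannKernel ν (starRingEnd ℂ z) x :=
    map_bargmannKernel Complex.conjCAE.toContinuousAlgHom ν z x
  rw [weighted, weighted, Complex.real_smul, map_mul, Complex.conj_ofReal, hconj, Complex.real_smul]

lemma toSliceSpace_smul_inverseIntegrand (ν : ℝ) (f : ℍ → ℍ) (x : ℝ) (z : ℂ) :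
    toSliceSpace hI ((ν / Real.pi) ^ (3 / 4 : ℝ) • inverseIntegrand ν I f x z)
      = adjointIntegrand ν (weighted ν (restrictSlice hI f)) x z := by
  rw [adjointIntegrand, conj_weighted_bargmannKernel, weighted_smul_weighted, restrictSlice,
    ← toSliceSpace_sliceMap_mul, ← kernel_sliceMap hI, ← star_sliceMap hI, ← map_smul, kernel,
    inverseIntegrand, norm_sliceMap hI, smul_mul_assoc, smul_comm]

lemma toSliceSpace_inverseIntegral (ν : ℝ) (s : Set ℂ) (f : ℍ → ℍ) (x : ℝ) :
    toSliceSpace hI (inverseIntegral ν I s f x)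
      = ∫ z in s, adjointIntegrand ν (weighted ν (restrictSlice hI f)) x z := by
  simp only [inverseIntegral, ← integral_smul, ← toSliceSpace_smul_inverseIntegrand]
  exact ((toSliceSpace hI).toContinuousLinearEquiv.integral_comp_comm _).symm

lemma integrable_inverseIntegrand_iff (hν : 0 < ν) {μ : Measure ℂ} {f : ℍ → ℍ} {x : ℝ} :
    Integrable (inverseIntegrand ν I f x) μ ↔
      Integrable (adjointIntegrand ν (weighted ν (restrictSlice hI f)) x) μ := by
  have hpos : 0 < (ν / Real.pi) ^ (3 / 4 : ℝ) := by positivity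
  have hfactor : adjointIntegrand ν (weighted ν (restrictSlice hI f)) x
      = toSliceSpace hI ∘ ((ν / Real.pi) ^ (3 / 4 : ℝ) • inverseIntegrand ν I f x) :=
    funext fun z => (toSliceSpace_smul_inverseIntegrand hI ν f x z).symm
  rw [← integrable_smul_iff hpos.ne', hfactor, ← memLp_one_iff_integrable,
    ← memLp_one_iff_integrable, memLp_toSliceSpace_comp_iff]

include hI in
theorem integrable_inverseIntegrand_of_norm_le (hν : 0 < ν) {f : ℍ → ℍ} (hf : SliceRegular f)
    {C a : ℝ} (ha : a < ν / 2) (hC : ∀ z : ℂ, ‖f (sliceMap I z)‖ ≤ C * Real.exp (a * ‖z‖ ^ 2))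
    (x : ℝ) : Integrable (inverseIntegrand ν I f x) := by
  have hcont : Continuous (restrictSlice hI f) :=
    ((sliceRegular_iff.1 hf).2 I hI).continuous
  have hgauss : Continuous fun z : ℂ => Real.exp (-(ν / 2) * ‖z‖ ^ 2) := by fun_prop
  rw [integrable_inverseIntegrand_iff hI hν]
  refine integrable_adjointIntegrand hν (((integrable_exp_neg_mul_norm_sq (V := ℂ)
    (sub_pos.2 ha)).const_mul C).mono' (hgauss.smul hcont).aestronglyMeasurable
      (ae_of_all _ fun z => ?_)) x
  calc ‖weighted ν (restrictSlice hI f) z‖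
      = Real.exp (-(ν / 2) * ‖z‖ ^ 2) * ‖f (sliceMap I z)‖ := by
        rw [weighted, norm_smul, Real.norm_of_nonneg (Real.exp_pos _).le, restrictSlice,
          LinearIsometryEquiv.norm_map]
    _ ≤ Real.exp (-(ν / 2) * ‖z‖ ^ 2) * (C * Real.exp (a * ‖z‖ ^ 2)) := by
        gcongr
        exact hC z
    _ = C * Real.exp (-(ν / 2 - a) * ‖z‖ ^ 2) := by
        rw [mul_left_comm, ← Real.exp_add]
        ring_nf

end InverseIntegral

section Polarization

variable {α β : Type*} [MeasurableSpace α] [MeasurableSpace β] {μ : Measure α} {κ : Measure β}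

lemma integrable_star_mul (φ ψ : Lp ℍ 2 μ) : Integrable (fun x => star (ψ x) * φ x) μ :=
  (Lp.memLp ψ).star.integrable_mul (Lp.memLp φ)

-- The real inner products with all right multiples of `ψ` determine the quaternionic one.
lemma inner_integral_star_mul (φ ψ : Lp ℍ 2 μ) (e : ℍ) :
    inner ℝ (∫ x, star (ψ x) * φ x ∂μ) e = inner ℝ φ (MulOpposite.op e • ψ) := by
  rw [real_inner_comm, ← integral_inner (integrable_star_mul φ ψ), L2.inner_def]
  refine integral_congr_ae ?_
  filter_upwards [Lp.coeFn_smul (MulOpposite.op e) ψ] with x hx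
  rw [hx, Pi.smul_apply, MulOpposite.smul_eq_mul_unop, MulOpposite.unop_op, real_inner_comm,
    inner_mul_left, star_star]

theorem integral_star_mul_eq_of_norm_eq {M : Type*} [AddCommGroup M] [Module ℍᵐᵒᵖ M]
    {S : M →ₗ[ℍᵐᵒᵖ] Lp ℍ 2 μ} {T : M →ₗ[ℍᵐᵒᵖ] Lp ℍ 2 κ} (h : ∀ m, ‖S m‖ = ‖T m‖) (m n : M) :
    ∫ x, star (S n x) * S m x ∂μ = ∫ y, star (T n y) * T m y ∂κ := by
  refine ext_inner_right ℝ fun e => ?_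
  rw [inner_integral_star_mul, inner_integral_star_mul]
  simp only [← map_smul, ← map_add, h,
    real_inner_eq_norm_add_mul_self_sub_norm_mul_self_sub_norm_mul_self_div_two]

lemma norm_Lp_two_sq {E : Type*} [NormedAddCommGroup E] [InnerProductSpace ℝ E] (g : Lp E 2 μ) :
    ‖g‖ ^ 2 = ∫ x, ‖g x‖ ^ 2 ∂μ := by
  simp only [← real_inner_self_eq_norm_sq, L2.inner_def]

end Polarization

section Unitary

variable {ν : ℝ} {I : ℍ} (hν : 0 < ν) (hI : I ^ 2 = -1)

/-- The Segal-Bargmann transform as a right `ℍ`-linear map into the Fock space. -/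
def transformLinear : L2 →ₗ[ℍᵐᵒᵖ] fock ν I where
  toFun ψ := ⟨transform ν ψ, transform_mem_fock hI hν (Lp.memLp ψ)⟩
  map_add' φ ψ := Subtype.ext <| by
    simp only [transform_eq_bargmannTransform, Submodule.coe_add]
    rw [bargmannTransform_congr_ae ν (Lp.coeFn_add φ ψ),
      bargmannTransform_add hν (Lp.memLp φ) (Lp.memLp ψ)]
  map_smul' c ψ := Subtype.ext <| by
    simp only [transform_eq_bargmannTransform, RingHom.id_apply, Submodule.coe_smul]
    rw [bargmannTransform_congr_ae ν (Lp.coeFn_smul c ψ),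
      bargmannTransform_smul hν c (Lp.memLp ψ)]

/-- The isometric embedding of the Fock space into `L²(ℂ; ℍ)` that restricts to `ℂ_I` and multiplies
by the square root of the Gaussian weight. -/
def fockToLp (ν : ℝ) : fock ν I →ₗ[ℍᵐᵒᵖ] Lp ℍ 2 (volume : Measure ℂ) where
  toFun f := ((mem_fock_iff hI).1 f.2).2.toLp
  map_add' f g := by
    rw [← MemLp.toLp_add]
    exact MemLp.toLp_congr _ _ (.of_eq (weighted_add ν (f.1 ∘ sliceMap I) (g.1 ∘ sliceMap I)))
  map_smul' c f := by
    rw [RingHom.id_apply, ← MemLp.toLp_const_smul]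
    exact MemLp.toLp_congr _ _ (.of_eq (funext fun z => smul_comm _ c _))

lemma coeFn_fockToLp (f : fock ν I) :
    fockToLp hI ν f =ᵐ[volume] weighted ν (f.1 ∘ sliceMap I) :=
  ((mem_fock_iff hI).1 f.2).2.coeFn_toLp

lemma norm_fockToLp_transformLinear (ψ : L2) :
    ‖fockToLp hI ν (transformLinear hν hI ψ)‖ = ‖ψ‖ := by
  rw [Lp.norm_def, Lp.norm_def, eLpNorm_congr_ae (coeFn_fockToLp hI _)]
  exact congrArg ENNReal.toReal (eLpNorm_weighted_transform hI hν (Lp.memLp ψ))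

theorem bijective_transformLinear : Function.Bijective (transformLinear hν hI) := by
  refine ⟨(injective_iff_map_eq_zero _).2 fun ψ hψ => ?_, fun f => ?_⟩
  · rw [← norm_eq_zero, ← norm_fockToLp_transformLinear hν hI, hψ, map_zero, norm_zero]
  · obtain ⟨ψ, hψ⟩ := exists_transform_eq hI hν f.2
    exact ⟨ψ, Subtype.ext hψ⟩

/-- The inverse of the Segal-Bargmann transform. -/
def inverseTransform : fock ν I ≃ₗ[ℍᵐᵒᵖ] L2 :=
  (LinearEquiv.ofBijective (transformLinear hν hI) (bijective_transformLinear hν hI)).symm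

lemma coe_inverseTransform_symm (ψ : L2) :
    ((inverseTransform hν hI).symm ψ : ℍ → ℍ) = transform ν ψ := rfl

variable (f g : fock ν I)

lemma transform_inverseTransform : transform ν (inverseTransform hν hI f) = f :=
  congrArg Subtype.val ((inverseTransform hν hI).symm_apply_apply f)

lemma norm_inverseTransform : ‖inverseTransform hν hI f‖ = ‖fockToLp hI ν f‖ := by
  rw [← norm_fockToLp_transformLinear hν hI]
  exact congrArg (‖fockToLp hI ν ·‖) ((inverseTransform hν hI).symm_apply_apply f)

lemma fockInner_eq_integral :
    fockInner ν I f g = ∫ z, star (fockToLp hI ν g z) * fockToLp hI ν f z := by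
  refine integral_congr_ae ?_
  filter_upwards [coeFn_fockToLp hI f, coeFn_fockToLp hI g] with z hf hg
  rw [hf, hg, norm_sliceMap hI, weighted, weighted, Quaternion.star_smul, smul_mul_smul_comm,
    ← Real.exp_add, Function.comp_apply, Function.comp_apply]
  ring_nf

theorem l2Inner_inverseTransform :
    l2Inner (inverseTransform hν hI f) (inverseTransform hν hI g) = fockInner ν I f g := by
  rw [fockInner_eq_integral hI]
  exact integral_star_mul_eq_of_norm_eq (S := (inverseTransform hν hI).toLinearMap)
    (norm_inverseTransform hν hI) f g

theorem norm_inverseTransform_sq : ‖inverseTransform hν hI f‖ ^ 2 = ∫ z, fockDensity ν I f z := by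
  rw [norm_inverseTransform, norm_Lp_two_sq]
  refine integral_congr_ae ?_
  filter_upwards [coeFn_fockToLp hI f] with z hz
  rw [hz, fockDensity_eq_norm_weighted_sq hI]

end Unitary

section InversionFormula

variable {ν : ℝ} {I : ℍ} (hν : 0 < ν) (hI : I ^ 2 = -1) (f : fock ν I)

lemma bargmannTransform_inverseTransform :
    bargmannTransform ν (toSliceSpace hI ∘ inverseTransform hν hI f) = restrictSlice hI f := by
  rw [← restrictSlice_transform, transform_inverseTransform]

include hν hI in
lemma integrableOn_ball_inverseIntegrand (R x : ℝ) :
    IntegrableOn (inverseIntegrand ν I f x) (Metric.ball 0 R) :=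
  (integrable_inverseIntegrand_iff hI hν).2
    (integrableOn_adjointIntegrand hν (memLp_two_weighted_restrictSlice hI f.2) R x)

lemma toSliceSpace_comp_inverseIntegral_ball (R : ℝ) :
    toSliceSpace hI ∘ inverseIntegral ν I (Metric.ball 0 R) f
      = truncatedAdjoint ν (weighted ν (restrictSlice hI f)) R :=
  funext fun x => toSliceSpace_inverseIntegral hI ν (Metric.ball 0 R) f x

include hν hI in
lemma memLp_two_inverseIntegral_ball (R : ℝ) :
    MemLp (inverseIntegral ν I (Metric.ball 0 R) f) 2 := by
  rw [← memLp_toSliceSpace_comp_iff hI, toSliceSpace_comp_inverseIntegral_ball]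
  exact memLp_two_truncatedAdjoint hν (memLp_two_weighted_restrictSlice hI f.2) R

theorem tendsto_eLpNorm_inverseIntegral_ball_sub :
    Tendsto (fun R : ℝ => eLpNorm (fun x => inverseIntegral ν I (Metric.ball 0 R) f x
      - inverseTransform hν hI f x) 2 volume) atTop (𝓝 0) := by
  have hlim := tendsto_eLpNorm_truncatedAdjoint_sub hν
    ((memLp_toSliceSpace_comp_iff hI).2 (Lp.memLp (inverseTransform hν hI f)))
  rw [bargmannTransform_inverseTransform] at hlim
  refine hlim.congr fun R => ?_
  rw [← toSliceSpace_comp_inverseIntegral_ball, ← eLpNorm_toSliceSpace_comp hI]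
  refine congrArg (eLpNorm · 2 volume) (funext fun x => ?_)
  exact ((toSliceSpace hI).map_sub _ _).symm

theorem ae_inverseTransform_eq_inverseIntegral :
    ∀ᵐ x : ℝ, Integrable (inverseIntegrand ν I f x) →
      inverseTransform hν hI f x = inverseIntegral ν I Set.univ f x := by
  have hae := ae_eq_integral_adjointIntegrand hν
    ((memLp_toSliceSpace_comp_iff hI).2 (Lp.memLp (inverseTransform hν hI f)))
  rw [bargmannTransform_inverseTransform] at hae
  filter_upwards [hae] with x hx hint
  refine (toSliceSpace hI).injective ?_
  rw [toSliceSpace_inverseIntegral, setIntegral_univ]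
  exact hx ((integrable_inverseIntegrand_iff hI hν).1 hint)

end InversionFormula

end SegalBargmann

end

theorem mainTheorem3 (ν : ℝ) (hν : 0 < ν) (I : ℍ) (hI : I ^ 2 = -1) :
    -- the transform is given by an absolutely convergent integral on all of `L²(ℝ; ℍ)`
    (∀ (ψ : SegalBargmann.L2) (q : ℍ),
      Integrable (fun x : ℝ => SegalBargmann.kernel ν q x * ψ x)) ∧
    ∃ U : SegalBargmann.fock ν I ≃ₗ[ℍᵐᵒᵖ] SegalBargmann.L2,
      -- `U` is the inverse of the transform
      (∀ ψ : SegalBargmann.L2, (U.symm ψ : ℍ → ℍ) = SegalBargmann.transform ν ψ) ∧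
      -- `U` is unitary
      (∀ f g : SegalBargmann.fock ν I,
        SegalBargmann.l2Inner (U f) (U g) = SegalBargmann.fockInner ν I f g) ∧
      (∀ f : SegalBargmann.fock ν I,
        ‖U f‖ ^ 2 = ∫ z : ℂ, SegalBargmann.fockDensity ν I f z) ∧
      -- the integral representation: in the mean over discs, for every `f`
      (∀ f : SegalBargmann.fock ν I,
        (∀ R : ℝ, (∀ x : ℝ, IntegrableOn (SegalBargmann.inverseIntegrand ν I f x)
            (Metric.ball 0 R)) ∧
          MemLp (SegalBargmann.inverseIntegral ν I (Metric.ball 0 R) f) 2 volume) ∧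
        Tendsto (fun R : ℝ => eLpNorm
            (fun x => SegalBargmann.inverseIntegral ν I (Metric.ball 0 R) f x - U f x) 2 volume)
          atTop (𝓝 0)) ∧
      -- and pointwise, wherever the integral over the whole slice converges absolutely
      (∀ f : SegalBargmann.fock ν I, ∀ᵐ x : ℝ,
        Integrable (SegalBargmann.inverseIntegrand ν I f x) →
          U f x = SegalBargmann.inverseIntegral ν I Set.univ f x) ∧
      -- which holds at all `x` under a subcritical growth bound
      (∀ f : SegalBargmann.fock ν I,
        (∃ C a : ℝ, a < ν / 2 ∧ ∀ z : ℂ,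
          ‖(f : ℍ → ℍ) (SegalBargmann.sliceMap I z)‖ ≤ C * Real.exp (a * ‖z‖ ^ 2)) →
        ∀ x : ℝ, Integrable (SegalBargmann.inverseIntegrand ν I f x)) := by
  refine ⟨fun ψ q => SegalBargmann.integrable_bargmannKernel_smul hν (Lp.memLp ψ) q,
    SegalBargmann.inverseTransform hν hI, SegalBargmann.coe_inverseTransform_symm hν hI,
    SegalBargmann.l2Inner_inverseTransform hν hI, SegalBargmann.norm_inverseTransform_sq hν hI,
    fun f => ⟨fun R => ⟨SegalBargmann.integrableOn_ball_inverseIntegrand hν hI f R,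
      SegalBargmann.memLp_two_inverseIntegral_ball hν hI f R⟩,
      SegalBargmann.tendsto_eLpNorm_inverseIntegral_ball_sub hν hI f⟩,
    SegalBargmann.ae_inverseTransform_eq_inverseIntegral hν hI, ?_⟩
  rintro f ⟨C, a, ha, hC⟩
  exact SegalBargmann.integrable_inverseIntegrand_of_norm_le hI hν f.2.1 ha hC
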